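/- **Setting.** Let $\mathbb{T}^+$ be $\mathbb{N}\cup\{0\}$ or $[0,\infty)$, and let $\lambda$ be the counting measure on $\mathbb{T}^+$ in the first case and the Lebesgue measure in the second. Let $(\Omega,\mathcal{F},(\mathcal{F}_t)_{t\in\mathbb{T}^+},\mathbb{P})$ be a filtered probability space, $\mathcal{F}_+:=\sigma(\mathcal{F}_t : t\in\mathbb{T}^+)$, and let $(\theta^t)_{t\in\mathbb{T}^+}$ be $\mathbb{P}$-preserving measurable maps $\Omega\to\Omega$ with $\theta^0=\mathrm{id}$ and $\theta^{s+t}=\theta^t\circ\theta^s$, such that $\theta^t$ is $(\mathcal{F}_{s+t},\mathcal{F}_s)$-measurable for all $s,t$, and $\mathcal{F}_t$ and $(\theta^{t})^{-1}\mathcal{F}_+$ are $\mathbb{P}$-independent for all $t$. Let $\mathbb{S}^1=\mathbb{R}/\mathbb{Z}$ with its quotient metric $d$ and Lebesgue measure $l$ ($l(\mathbb{S}^1)=1$). Let $\varphi=(\varphi(t,\omega))_{t\in\mathbb{T}^+,\,\omega\in\Omega}$ be a family of orientation-preserving homeomorphisms of $\mathbb{S}^1$ such that: $(\omega,x)\mapsto\varphi(t,\omega)x$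 is $\mathcal{F}_t\otimes\mathcal{B}(\mathbb{S}^1)$-measurable for each $t$; $\varphi(0,\omega)=\mathrm{id}$; $\varphi(s+t,\omega)=\varphi(t,\theta^s\omega)\circ\varphi(s,\omega)$; $\varphi(t_n,\omega)x_n\to\varphi(t,\omega)x$ whenever $(t_n)$ is decreasing with $t_n\to t$ and $x_n\to x$; and there is $\varphi_-:\mathbb{T}^+\times\Omega\times\mathbb{S}^1\to\mathbb{S}^1$ such that $\varphi(t_n,\omega)x_n\to\varphi_-(t,\omega,x)$ whenever $(t_n)$ is strictly increasing with $t_n\to t$ and $x_n\to x$. **Definitions.** A point $p$ is a *deterministic fixed point* if for $\mathbb{P}$-almost every $\omega$, $\varphi(t,\omega)p=p$ for all $t$. Write $x\sim_\omega y$ if $d(\varphi(t,\omega)x,\varphi(t,\omega)y)\to0$ as $t\to\infty$. The system $\varphi$ is *stably synchronising* if for all $x,y$, $x\sim_\omega y$ for $\mathbb{P}$-almost every $\omega$, and for all $x$, for $\mathbb{P}$-almost every $\omega$ there is an open $U\ni x$ with $l(\varphi(t,\omega)U)\to0$ as $t\to\infty$. A point $r$ is a *crack point* of $\omega$ if $l(\varphi(t,\omega)G)\to0$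 as $t\to\infty$ for every closed $G\subset\mathbb{S}^1$ with $r\notin G$ (such an $r$ is unique if it exists); it is *repulsive* if moreover the equivalence classes of $\sim_\omega$ are exactly $\{r\}$ and $\mathbb{S}^1\setminus\{r\}$. Let $\Omega_c$ be the set of $\omega$ that admit a crack point, and $\tilde r(\omega)$ the crack point of $\omega\in\Omega_c$. A probability measure $\rho$ on $\mathbb{S}^1$ is *stationary* if $\rho(A)=\int_{\mathbb{S}^1}\mathbb{P}(\omega:\varphi(t,\omega)x\in A)\,\rho(dx)$ for all $t\in\mathbb{T}^+$ and all Borel $A$. **Theorem 4.5.** The set $\Omega_c$ is $\mathcal{F}_+$-measurable and $\mathbb{P}(\Omega_c)\in\{0,1\}$. If $\mathbb{P}(\Omega_c)=1$, then either (a) $\mathbb{P}(\omega\in\Omega_c:\tilde r(\omega)=x)=0$ for every $x\in\mathbb{S}^1$; or (b) there is a deterministic fixed point $p\in\mathbb{S}^1$ with $\mathbb{P}(\omega\in\Omega_c:\tilde r(\omega)=p)=1$. The system $\varphi$ is stably synchronising if and only if $\mathbb{P}(\Omega_c)=1$ and (a) holds. In this case: (I) for $\mathbb{P}$-almost every $\omega\in\Omega_c$,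 $\tilde r(\omega)$ is a repulsive crack point of $\omega$; (II) there is exactly one stationary probability measure $\rho_{\mathrm{stat}}$, and for every connected $J\subset\mathbb{S}^1$ whose boundary $\partial J$ contains no deterministic fixed point, $\mathbb{P}$-almost every $\omega\in\Omega_c$ has the property that for all $x\in\mathbb{S}^1\setminus\{\tilde r(\omega)\}$, $$\frac1T\int_{\mathbb{T}^+\cap[0,T)}\mathbf{1}_J(\varphi(t,\omega)x)\,\lambda(dt)\;\to\;\rho_{\mathrm{stat}}(J)\qquad\text{as } T\to\infty .$$ -/

import Mathlib

open MeasureTheory Filter Topology ProbabilityTheory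
open scoped NNReal ENNReal

/-- The circle `ℝ / ℤ`, with its quotient metric and its Lebesgue measure `volume` of mass one. -/
abbrev Circ : Type := UnitAddCircle

/-- The two possible kinds of time. -/
inductive TimeDomain : Type
  | discrete
  | continuous

/-- The set of times, `{0, 1, 2, …}` or `[0, ∞)`, as an additive submonoid of `[0, ∞)`. -/
def TimeDomain.carrier : TimeDomain → AddSubmonoid ℝ≥0
  | .discrete => AddMonoidHom.mrange (Nat.castAddMonoidHom ℝ≥0)
  | .continuous => ⊤

/-- The type of times. -/
abbrev TimeDomain.Time (k : TimeDomain) : Type := k.carrier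

/-- Counting measure in discrete time, Lebesgue measure in continuous time. -/
noncomputable def TimeDomain.timeMeasure : (k : TimeDomain) → Measure k.Time
  | .discrete => Measure.count
  | .continuous => Measure.comap (fun t => ((t : ℝ≥0) : ℝ)) volume

section Noise

variable {k : TimeDomain} {Ω : Type*} [mΩ : MeasurableSpace Ω]

/-- The σ-algebra generated by all the `ℱ t`. -/
abbrev futureSigma (ℱ : Filtration k.Time mΩ) : MeasurableSpace Ω := ⨆ t, ℱ t

/-- `θ` is a semigroup of measure-preserving time shifts on the filtered probability space
`(Ω, ℱ, P)`, and the noise is memoryless. -/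
structure IsNoise (P : Measure Ω) (ℱ : Filtration k.Time mΩ) (θ : k.Time → Ω → Ω) : Prop where
  measurePreserving : ∀ t, MeasurePreserving (θ t) P P
  zero : θ 0 = id
  add : ∀ s t, θ (s + t) = θ t ∘ θ s
  adapted : ∀ s t, Measurable[ℱ (s + t), ℱ s] (θ t)
  indep : ∀ t, Indep (ℱ t) ((futureSigma ℱ).comap (θ t)) P

/-- A homeomorphism of the circle preserves the orientation if it has a continuous nondecreasing
lift `F : ℝ → ℝ` with `F (x + 1) = F x + 1`. -/
def OrientationPreserving (f : Circ ≃ₜ Circ) : Prop :=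
  ∃ F : CircleDeg1Lift, Continuous F ∧ ∀ x : ℝ, ((F x : ℝ) : Circ) = f (x : Circ)

/-- `φ` is an invertible (orientation-preserving, càdlàg) random dynamical system on the circle
over the noise `(ℱ, θ)`. -/
structure IsRDS (ℱ : Filtration k.Time mΩ) (θ : k.Time → Ω → Ω)
    (φ : k.Time → Ω → (Circ ≃ₜ Circ)) : Prop where
  orientationPreserving : ∀ t ω, OrientationPreserving (φ t ω)
  measurable : ∀ t,
    Measurable[(ℱ t).prod (inferInstance : MeasurableSpace Circ)]
      (fun p : Ω × Circ => φ t p.1 p.2)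
  zero : ∀ ω x, φ 0 ω x = x
  cocycle : ∀ s t ω x, φ (s + t) ω x = φ t (θ s ω) (φ s ω x)
  right_continuous : ∀ (u : ℕ → k.Time) (t : k.Time) (x : ℕ → Circ) (y : Circ),
    Antitone u → Tendsto u atTop (𝓝 t) → Tendsto x atTop (𝓝 y) →
      ∀ ω, Tendsto (fun n => φ (u n) ω (x n)) atTop (𝓝 (φ t ω y))
  left_limits : ∃ φm : k.Time → Ω → Circ → Circ,
    ∀ (u : ℕ → k.Time) (t : k.Time) (x : ℕ → Circ) (y : Circ),
      StrictMono u → Tendsto u atTop (𝓝 t) → Tendsto x atTop (𝓝 y) →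
        ∀ ω, Tendsto (fun n => φ (u n) ω (x n)) atTop (𝓝 (φm t ω y))

/-- `p` is a deterministic fixed point of `φ`. -/
def IsDetFixedPoint (P : Measure Ω) (φ : k.Time → Ω → (Circ ≃ₜ Circ)) (p : Circ) : Prop :=
  ∀ᵐ ω ∂P, ∀ t, φ t ω p = p

/-- The trajectories of `x` and `y` synchronise under the noise realisation `ω`. -/
def Synced (φ : k.Time → Ω → (Circ ≃ₜ Circ)) (ω : Ω) (x y : Circ) : Prop :=
  Tendsto (fun t => dist (φ t ω x) (φ t ω y)) atTop (𝓝 0)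

def Synchronising (P : Measure Ω) (φ : k.Time → Ω → (Circ ≃ₜ Circ)) : Prop :=
  ∀ x y, ∀ᵐ ω ∂P, Synced φ ω x y

def EverywhereLocallyStable (P : Measure Ω) (φ : k.Time → Ω → (Circ ≃ₜ Circ)) : Prop :=
  ∀ x, ∀ᵐ ω ∂P, ∃ U : Set Circ, IsOpen U ∧ x ∈ U ∧
    Tendsto (fun t => volume (φ t ω '' U)) atTop (𝓝 0)

def StablySynchronising (P : Measure Ω) (φ : k.Time → Ω → (Circ ≃ₜ Circ)) : Prop :=
  Synchronising P φ ∧ EverywhereLocallyStable P φ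

/-- `r` is a crack point of `ω`: every closed set that avoids `r` is contracted to length zero. -/
def IsCrackPoint (φ : k.Time → Ω → (Circ ≃ₜ Circ)) (ω : Ω) (r : Circ) : Prop :=
  ∀ G : Set Circ, IsClosed G → r ∉ G → Tendsto (fun t => volume (φ t ω '' G)) atTop (𝓝 0)

/-- `r` is a crack point of `ω` and the classes of the relation `Synced φ ω` are `{r}` and its
complement. -/
def IsRepulsiveCrackPoint (φ : k.Time → Ω → (Circ ≃ₜ Circ)) (ω : Ω) (r : Circ) : Prop :=
  IsCrackPoint φ ω r ∧ ∀ x y, Synced φ ω x y ↔ (x = r ↔ y = r)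

/-- The set of contractive sample points, i.e. those that admit a crack point. -/
def contractiveSet (φ : k.Time → Ω → (Circ ≃ₜ Circ)) : Set Ω := {ω | ∃ r, IsCrackPoint φ ω r}

/-- The crack point of a contractive sample point (it is unique: `IsCrackPoint.unique`). -/
noncomputable def crackPoint (φ : k.Time → Ω → (Circ ≃ₜ Circ)) (ω : contractiveSet φ) : Circ :=
  ω.2.choose

/-- The event that the sample point is contractive with crack point `x`. -/
def crackEvent (φ : k.Time → Ω → (Circ ≃ₜ Circ)) (x : Circ) : Set Ω :=
  {ω | ∃ h : ω ∈ contractiveSet φ, crackPoint φ ⟨ω, h⟩ = x}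

/-- The probability measure `ρ` is stationary for the transition probabilities
`(x, t) ↦ P (φ t · x ∈ A)`. -/
def IsStationaryMeasure (P : Measure Ω) (φ : k.Time → Ω → (Circ ≃ₜ Circ))
    (ρ : Measure Circ) : Prop :=
  IsProbabilityMeasure ρ ∧
    ∀ t, ∀ A : Set Circ, MeasurableSet A → ρ A = ∫⁻ x, P {ω | φ t ω x ∈ A} ∂ρ

/-- The proportion of time before `T` that the trajectory of `x` spends in `J`. -/
noncomputable def timeAverage (φ : k.Time → Ω → (Circ ≃ₜ Circ)) (ω : Ω) (x : Circ)
    (J : Set Circ) (T : ℝ) : ℝ :=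
  1 / T * ∫ t in {t : k.Time | ((t : ℝ≥0) : ℝ) < T},
    J.indicator (fun _ => (1 : ℝ)) (φ t ω x) ∂k.timeMeasure

end Noise

theorem IsCrackPoint.unique {k : TimeDomain} {Ω : Type*} {φ : k.Time → Ω → (Circ ≃ₜ Circ)}
    {ω : Ω} {r q : Circ}
    (hr : IsCrackPoint φ ω r) (hq : IsCrackPoint φ ω q) : r = q := by
  by_contra hne
  obtain ⟨U, V, hU, hV, hrU, hqV, hd⟩ := t2_separation hne
  have h1 := hr Uᶜ hU.isClosed_compl (by simpa using hrU)
  have h2 := hq Vᶜ hV.isClosed_compl (by simpa using hqV)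
  have h := h1.add h2
  have key : ∀ t, (1 : ℝ≥0∞) ≤ volume (φ t ω '' Uᶜ) + volume (φ t ω '' Vᶜ) := by
    intro t
    refine le_trans ?_ (measure_union_le _ _)
    rw [← Set.image_union, ← Set.compl_inter, hd.inter_eq, Set.compl_empty, Set.image_univ,
      (φ t ω).surjective.range_eq, UnitAddCircle.measure_univ]
  have := ge_of_tendsto' h key
  simp at this

/-! ### Geometry of the circle -/

/-! Everything rests on restarting the system at a time `s`. By the cocycle property, contraction
under `ω` is contraction of the images at time `s` under the noise `θ s ω`, and this fresh noise is
independent of `ℱ s`. So contractivity is shift invariant, hence independent of every `ℱ s` and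
finally of itself, and the crack point is carried by the flow: `crackFun φ (θ s ω) = φ s ω (crackFun
φ ω)`.

Dichotomy (`crackPoint_dichotomy`). Let `μ` be the law of the crack point. Given `ℱ s`, the crack
point is `x` with probability `μ {φ s ω x}`. At a heaviest atom `p` these values average to their
upper bound, so they are almost surely constant. The event that the crack point is `p` is then
independent of the past, has probability one, and `p` cannot move.

Stable synchronisation. If the crack point has no atoms, it almost surely avoids any given points,
and stable synchronisation follows. Conversely, the ends of an arc approach each other, and by local
stability and compactness fresh noise very probably contracts a ball containing both. That ball
contains the image of the arc or of its complement, so one of the two is contracted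
(`StablySynchronising.ae_isContracted_or`). Applied to countably many balls at every scale, this
locates the crack point by compactness.

Repulsion (`ae_not_synced_crackFun`). The crack point of the fresh noise has a diffuse law and is
independent of where a given trajectory stands, so at each time the two are unlikely to be close.

Stationarity. Synchronisation makes expectations forget the initial point, which gives existence and
uniqueness of the stationary measure; local stability makes the convergence uniform. A test function
minus its conditional expectation a time `m` earlier is uncorrelated at lags of at least `m`, whence
a law of large numbers for one trajectory, passed on by synchronisation to all others off the crack
point. The heaviest atoms of the stationary measure are permuted by the flow and merged by
synchronisation, so only a deterministic fixed point can be an atom. Hence the frontier of `J` is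
null, and `J` can be squeezed between continuous functions. -/

theorem Circ.norm_coe {s : ℝ} (hs : |s| ≤ 1 / 2) : ‖(s : Circ)‖ = |s| := by
  have := (AddCircle.norm_coe_eq_abs_iff (p := (1 : ℝ)) (x := s) one_ne_zero).2 (by simpa using hs)
  exact this

theorem Circ.exists_norm_eq (z : Circ) : ∃ s : ℝ, |s| ≤ 1 / 2 ∧ |s| = ‖z‖ ∧ (s : Circ) = z := by
  obtain ⟨b, rfl⟩ := QuotientAddGroup.mk_surjective z
  refine ⟨b - round b, abs_sub_round b, ?_, ?_⟩
  · exact (UnitAddCircle.norm_eq (x := b)).symm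
  · rw [AddCircle.coe_sub, sub_eq_self]
    exact AddCircle.coe_eq_zero_iff (1 : ℝ) |>.2 ⟨round b, by simp⟩

theorem Circ.norm_coe_le (s : ℝ) : ‖(s : Circ)‖ ≤ |s| := by
  rcases le_total |s| (1 / 2) with h | h
  · exact (Circ.norm_coe h).le
  · have := AddCircle.norm_le_half_period (p := (1 : ℝ)) (x := (s : Circ)) one_ne_zero
    rw [abs_one] at this
    exact this.trans h

theorem Circ.continuous_add_coe (x : Circ) : Continuous fun s : ℝ => x + (s : Circ) :=
  continuous_const.add (AddCircle.continuous_mk' (1 : ℝ))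

theorem Circ.isPreconnected_ball (x : Circ) (r : ℝ) : IsPreconnected (Metric.ball x r) := by
  have : Metric.ball x r = (fun s : ℝ => x + (s : Circ)) '' Set.Ioo (-r) r := by
    ext z
    simp only [Metric.mem_ball, dist_eq_norm, Set.mem_image, Set.mem_Ioo, ← abs_lt]
    constructor
    · intro h
      obtain ⟨s, -, hs, hz⟩ := Circ.exists_norm_eq (z - x)
      exact ⟨s, by rwa [hs], by rw [hz]; abel⟩
    · rintro ⟨s, hs, rfl⟩
      simpa using (Circ.norm_coe_le s).trans_lt hs
  rw [this]
  exact isPreconnected_Ioo.image _ (Circ.continuous_add_coe x).continuousOn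

/-- The complement of a ball is the arc through the antipode of the centre, covered by the interval
`[r, 1 - r]`. -/
theorem Circ.isPreconnected_compl_ball (x : Circ) (r : ℝ) :
    IsPreconnected (Metric.ball x r)ᶜ := by
  rcases le_or_gt r 0 with hr | hr
  · rw [Metric.ball_eq_empty.2 hr, Set.compl_empty]
    exact isPreconnected_univ
  have hper : ∀ s : ℝ, ((s - 1 : ℝ) : Circ) = (s : Circ) := fun s => by
    rw [AddCircle.coe_sub, sub_eq_self]
    exact AddCircle.coe_period (1 : ℝ)
  have : (Metric.ball x r)ᶜ = (fun s : ℝ => x + (s : Circ)) '' Set.Icc r (1 - r) := by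
    ext z
    simp only [Set.mem_compl_iff, Metric.mem_ball, dist_eq_norm, Set.mem_image, Set.mem_Icc, not_lt]
    constructor
    · intro h
      obtain ⟨s, hs2, hs, hz⟩ := Circ.exists_norm_eq (z - x)
      rw [← hs] at h
      rw [abs_le] at hs2
      rcases le_total 0 s with h0 | h0
      · rw [abs_of_nonneg h0] at h
        exact ⟨s, ⟨h, by linarith⟩, by rw [hz]; abel⟩
      · rw [abs_of_nonpos h0] at h
        refine ⟨s + 1, ⟨by linarith, by linarith⟩, ?_⟩
        rw [← hper (s + 1), add_sub_cancel_right, hz]; abel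
    · rintro ⟨s, ⟨h1, h2⟩, rfl⟩
      rw [add_sub_cancel_left]
      rcases le_total s (1 / 2) with h | h
      · rw [Circ.norm_coe (by rw [abs_of_nonneg (by linarith)]; exact h),
          abs_of_nonneg (by linarith)]
        exact h1
      · rw [← hper, Circ.norm_coe (by rw [abs_of_nonpos (by linarith)]; linarith),
          abs_of_nonpos (by linarith)]
        linarith
  rw [this]
  exact isPreconnected_Icc.image _ (Circ.continuous_add_coe x).continuousOn

theorem Circ.sphere_subset (x : Circ) (r : ℝ) :
    Metric.sphere x r ⊆ {x + (r : Circ), x + ((-r : ℝ) : Circ)} := by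
  intro z hz
  rw [mem_sphere_iff_norm] at hz
  obtain ⟨s, -, hs, hz'⟩ := Circ.exists_norm_eq (z - x)
  have hzs : z = x + (s : Circ) := by rw [hz']; abel
  have hsr : |s| = r := hs.trans hz
  rcases abs_choice s with h | h
  · left; rw [hzs, show s = r by linarith]
  · right; rw [Set.mem_singleton_iff, hzs, show s = -r by linarith]

theorem Circ.frontier_closedBall_subset (x : Circ) (r : ℝ) :
    frontier (Metric.closedBall x r) ⊆ {x + (r : Circ), x + ((-r : ℝ) : Circ)} :=
  Metric.frontier_closedBall_subset_sphere.trans (Circ.sphere_subset x r)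

/-- A connected set is at least as long as the distance between any two of its points. -/
theorem Circ.dist_le_volume {S : Set Circ} (hS : IsPreconnected S) (hm : MeasurableSet S)
    {a b : Circ} (ha : a ∈ S) (hb : b ∈ S) : ENNReal.ofReal (dist a b) ≤ volume S := by
  have hpre : MeasurableSet ((fun s : ℝ => a + (s : Circ)) ⁻¹' S) :=
    (Circ.continuous_add_coe a).measurable hm
  -- `A` lifts `S` to the window `(-1/2, 1/2]` centred at `a`, where the distance to `a` is the
  -- absolute value.
  set A : Set ℝ := (fun s : ℝ => a + (s : Circ)) ⁻¹' S ∩ Set.Ioc (-(1 / 2)) (1 / 2) with hA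
  have hAm : MeasurableSet A := hpre.inter measurableSet_Ioc
  have hvol : volume S = volume A := by
    have h1 := UnitAddCircle.measurePreserving_mk (-(1 / 2))
    have h2 : volume ((fun z : Circ => a + z) ⁻¹' S) = volume S := measure_preimage_add _ _ _
    rw [← h2, ← h1.measure_preimage (measurable_const_add a hm).nullMeasurableSet,
      Measure.restrict_apply (h1.measurable (measurable_const_add a hm)), hA]
    norm_num
    rfl
  -- On the connected set `S` the distance to `a` takes every value up to `dist a b`. Each value `s`
  -- is taken at `a + s` or `a - s`, so `A ∩ Ioi 0` and the reflection of `A ∩ Iio 0` cover.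
  have hcov : Set.Ioo 0 (dist a b) ⊆ (A ∩ Set.Ioi 0) ∪ Neg.neg ⁻¹' (A ∩ Set.Iio 0) := by
    intro s hs
    have him : Set.Icc 0 (dist a b) ⊆ (fun z => dist a z) '' S := by
      have := (hS.image (fun z => dist a z) (by fun_prop)).Icc_subset
        (Set.mem_image_of_mem _ ha) (Set.mem_image_of_mem _ hb)
      simpa using this
    obtain ⟨z, hz, hzs⟩ := him ⟨hs.1.le, hs.2.le⟩
    simp only at hzs
    obtain ⟨u, hu2, hu, hz'⟩ := Circ.exists_norm_eq (z - a)
    have hzu : z = a + (u : Circ) := by rw [hz']; abel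
    rw [dist_comm, dist_eq_norm, ← hu] at hzs
    have hs2 : s ≤ 1 / 2 := hzs ▸ hu2
    rcases abs_choice u with h | h
    · left
      have : u = s := by linarith
      subst this
      exact ⟨⟨by simpa [← hzu] using hz, by linarith [hs.1], hs2⟩, hs.1⟩
    · have hus : u = -s := by linarith
      subst hus
      -- The window omits `-1/2`; the antipode of `a` is counted on the positive side instead.
      rcases hs2.lt_or_eq with h3 | h3
      · right
        exact ⟨⟨by change a + ((-s : ℝ) : Circ) ∈ S; rwa [← hzu], by linarith, by linarith [hs.1]⟩,
          by simpa using hs.1⟩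
      · left
        refine ⟨⟨?_, by linarith [hs.1], hs2⟩, hs.1⟩
        have : ((s : ℝ) : Circ) = ((-s : ℝ) : Circ) := by
          rw [show s = -s + 1 by linarith, AddCircle.coe_add_period]
          congr 1; linarith
        change a + (s : Circ) ∈ S
        rwa [this, ← hzu]
  calc ENNReal.ofReal (dist a b) = volume (Set.Ioo 0 (dist a b)) := by simp
    _ ≤ volume (A ∩ Set.Ioi 0) + volume (Neg.neg ⁻¹' (A ∩ Set.Iio 0)) :=
        (measure_mono hcov).trans (measure_union_le _ _)
    _ = volume (A ∩ Set.Ioi 0) + volume (A ∩ Set.Iio 0) := by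
        congr 1
        exact Measure.measure_preimage_neg _ _
    _ = volume (A ∩ Set.Ioi 0 ∪ A ∩ Set.Iio 0) := by
        rw [measure_union _ (hAm.inter measurableSet_Iio)]
        exact Set.disjoint_left.2 fun s h1 h2 => lt_asymm (Set.mem_Ioi.1 h1.2) (Set.mem_Iio.1 h2.2)
    _ ≤ volume S := by
        rw [hvol]
        exact measure_mono (Set.union_subset Set.inter_subset_left Set.inter_subset_left)

theorem Circ.exists_mem_Ioo {r x : Circ} {r₀ : ℝ} (hr : (r₀ : Circ) = r) (hx : x ≠ r) :
    ∃ s ∈ Set.Ioo r₀ (r₀ + 1), (s : Circ) = x := by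
  have : x ∈ ((↑) : ℝ → Circ) '' Set.Ico r₀ (r₀ + 1) := by
    rw [AddCircle.coe_image_Ico_eq]; trivial
  obtain ⟨s, hs, rfl⟩ := this
  refine ⟨s, ⟨lt_of_le_of_ne hs.1 ?_, hs.2⟩, rfl⟩
  rintro rfl
  exact hx hr

theorem Circ.exists_arc {r x y : Circ} (hx : x ≠ r) (hy : y ≠ r) :
    ∃ G : Set Circ, IsClosed G ∧ IsPreconnected G ∧ x ∈ G ∧ y ∈ G ∧ r ∉ G := by
  obtain ⟨r₀, hr⟩ := QuotientAddGroup.mk_surjective r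
  obtain ⟨s, hs, rfl⟩ := Circ.exists_mem_Ioo hr hx
  obtain ⟨t, ht, rfl⟩ := Circ.exists_mem_Ioo hr hy
  have hsub : Set.uIcc s t ⊆ Set.Ioo r₀ (r₀ + 1) := by
    intro u hu
    rcases Set.mem_uIcc.1 hu with h | h
    · exact ⟨hs.1.trans_le h.1, h.2.trans_lt ht.2⟩
    · exact ⟨ht.1.trans_le h.1, h.2.trans_lt hs.2⟩
  have hc : Continuous ((↑) : ℝ → Circ) := AddCircle.continuous_mk' (1 : ℝ)
  refine ⟨((↑) : ℝ → Circ) '' Set.uIcc s t, (isCompact_uIcc.image hc).isClosed,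
    isPreconnected_uIcc.image _ hc.continuousOn, ⟨s, Set.left_mem_uIcc, rfl⟩,
    ⟨t, Set.right_mem_uIcc, rfl⟩, ?_⟩
  rintro ⟨u, hu, hur⟩
  have h := hsub hu
  have := (AddCircle.coe_eq_coe_iff_of_mem_Ico (p := (1 : ℝ)) (a := r₀) (x := u) (y := r₀)
    ⟨h.1.le, h.2⟩ ⟨le_rfl, by linarith⟩).1 (hur.trans hr.symm)
  exact absurd this h.1.ne'

/-- Cutting the circle at a point outside `J` turns `J` into an interval, and the frontier lies over
its two ends. -/
theorem Circ.finite_frontier {J : Set Circ} (hJ : IsPreconnected J) : (frontier J).Finite := by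
  by_cases hu : J = Set.univ
  · simp [hu]
  rcases J.eq_empty_or_nonempty with rfl | hne
  · simp
  obtain ⟨r, hr⟩ := (Set.ne_univ_iff_exists_notMem J).1 hu
  obtain ⟨r₀, hr₀⟩ := QuotientAddGroup.mk_surjective r
  have hc : Continuous ((↑) : ℝ → Circ) := AddCircle.continuous_mk' (1 : ℝ)
  set I : Set ℝ :=
    (fun z : Circ => ((AddCircle.equivIco (1 : ℝ) r₀ z : Set.Ico r₀ (r₀ + 1)) : ℝ)) '' J with hI
  have hIpre : IsPreconnected I := by
    refine hJ.image _ fun z hz => ContinuousAt.continuousWithinAt ?_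
    have : z ≠ (r₀ : Circ) := fun h => hr (by rw [← hr₀]; exact h ▸ hz)
    exact continuous_subtype_val.continuousAt.comp (AddCircle.continuousAt_equivIco (1 : ℝ) r₀ this)
  have hJI : ((↑) : ℝ → Circ) '' I = J := by
    rw [hI, Set.image_image]
    simp only [AddCircle.coe_equivIco, Set.image_id']
  have hIsub : I ⊆ Set.Icc r₀ (r₀ + 1) := by
    rintro _ ⟨z, -, rfl⟩
    exact Set.Ico_subset_Icc_self (AddCircle.equivIco (1 : ℝ) r₀ z).2
  have hbb : BddBelow I := bddBelow_Icc.mono hIsub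
  have hba : BddAbove I := bddAbove_Icc.mono hIsub
  have h1 := IsConnected.Ioo_csInf_csSup_subset ⟨hne.image _, hIpre⟩ hbb hba
  have h2 := subset_Icc_csInf_csSup hbb hba
  have hopen : IsOpen (((↑) : ℝ → Circ) '' Set.Ioo (sInf I) (sSup I)) :=
    QuotientAddGroup.isOpenMap_coe _ isOpen_Ioo
  have hIntg : ((↑) : ℝ → Circ) '' Set.Ioo (sInf I) (sSup I) ⊆ interior J :=
    interior_maximal ((Set.image_mono h1).trans hJI.subset) hopen
  have hcl : closure J ⊆ ((↑) : ℝ → Circ) '' Set.Icc (sInf I) (sSup I) :=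
    closure_minimal (hJI.symm.subset.trans (Set.image_mono h2)) (isCompact_Icc.image hc).isClosed
  refine (Set.toFinite {((sInf I : ℝ) : Circ), ((sSup I : ℝ) : Circ)}).subset ?_
  rintro z ⟨hz1, hz2⟩
  obtain ⟨s, hs, rfl⟩ := hcl hz1
  by_contra hcon
  simp only [Set.mem_insert_iff, Set.mem_singleton_iff, not_or] at hcon
  refine hz2 (hIntg ⟨s, ⟨lt_of_le_of_ne hs.1 ?_, lt_of_le_of_ne hs.2 ?_⟩, rfl⟩)
  · intro h; exact hcon.1 (by rw [h])
  · intro h; exact hcon.2 (by rw [h])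

theorem Circ.measurableSet_of_isPreconnected {J : Set Circ} (hJ : IsPreconnected J) :
    MeasurableSet J := by
  have : J = interior J ∪ (J ∩ frontier J) := by
    ext z
    constructor
    · intro hz
      by_cases h : z ∈ interior J
      · exact Or.inl h
      · exact Or.inr ⟨hz, subset_closure hz, h⟩
    · rintro (h | h)
      · exact interior_subset h
      · exact h.1
  rw [this]
  exact isOpen_interior.measurableSet.union
    ((Circ.finite_frontier hJ).subset Set.inter_subset_right).measurableSet

/-- A set whose frontier lies in a ball is contained in the ball, or its complement is. -/
theorem Circ.subset_ball_or_compl_subset_ball {C : Set Circ} {x : Circ} {r : ℝ}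
    (h : frontier C ⊆ Metric.ball x r) : C ⊆ Metric.ball x r ∨ Cᶜ ⊆ Metric.ball x r := by
  by_contra hcon
  rw [not_or, Set.not_subset, Set.not_subset] at hcon
  obtain ⟨⟨y, hyC, hy⟩, ⟨z, hzC, hz⟩⟩ := hcon
  -- Off the ball `C` has no frontier, so its interior and exterior would disconnect the complement
  -- of the ball.
  have hcov : ∀ w ∈ (Metric.ball x r)ᶜ, w ∈ interior C ∨ w ∈ (closure C)ᶜ := by
    intro w hw
    by_contra hcon
    rw [not_or, Set.notMem_compl_iff] at hcon
    exact hw (h ⟨hcon.2, hcon.1⟩)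
  obtain ⟨w, -, hw1, hw2⟩ := Circ.isPreconnected_compl_ball x r (interior C) (closure C)ᶜ
    isOpen_interior isClosed_closure.isOpen_compl hcov
    ⟨y, hy, (hcov y hy).resolve_right fun h => h (subset_closure hyC)⟩
    ⟨z, hz, (hcov z hz).resolve_left fun h => hzC (interior_subset h)⟩
  exact hw2 (interior_subset_closure hw1)

/-! ### Times -/

namespace TimeDomain

variable {k : TimeDomain}

theorem natCast_mem (k : TimeDomain) (n : ℕ) : (n : ℝ≥0) ∈ k.carrier := by
  cases k
  · exact ⟨n, rfl⟩
  · trivial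

/-- A natural number as a time. -/
def natTime (k : TimeDomain) (n : ℕ) : k.Time := ⟨n, k.natCast_mem n⟩

@[simp] theorem coe_natTime (n : ℕ) : ((k.natTime n : k.Time) : ℝ≥0) = n := rfl

theorem exists_natTime_ge (t : k.Time) : ∃ n : ℕ, t ≤ k.natTime n := by
  obtain ⟨n, hn⟩ := exists_nat_ge (t : ℝ≥0)
  exact ⟨n, hn⟩

theorem natTime_mono : Monotone k.natTime := fun _ _ h =>
  Nat.cast_le (α := ℝ≥0).2 h

theorem tendsto_natTime : Tendsto k.natTime atTop atTop :=
  tendsto_atTop_atTop_of_monotone natTime_mono exists_natTime_ge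

theorem exists_add_eq {s t : k.Time} (h : s ≤ t) : ∃ u : k.Time, s + u = t := by
  cases k
  · obtain ⟨_, m, rfl⟩ := s
    obtain ⟨_, n, rfl⟩ := t
    have hmn : m ≤ n := by
      have : ((m : ℕ) : ℝ≥0) ≤ (n : ℝ≥0) := h
      exact_mod_cast this
    refine ⟨natTime _ (n - m), Subtype.ext ?_⟩
    change (m : ℝ≥0) + ((n - m : ℕ) : ℝ≥0) = (n : ℝ≥0)
    rw [← Nat.cast_add, Nat.add_sub_cancel' hmn]
  · exact ⟨⟨(t : ℝ≥0) - s, trivial⟩, Subtype.ext (add_tsub_cancel_of_le h)⟩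

theorem tendsto_add_atTop_iff {α : Type*} {f : k.Time → α} {l : Filter α} (s : k.Time) :
    Tendsto (fun t => f (s + t)) atTop l ↔ Tendsto f atTop l := by
  constructor
  · intro h S hS
    obtain ⟨N, hN⟩ := eventually_atTop.1 (h hS)
    refine mem_map.2 (mem_atTop_sets.2 ⟨s + N, fun t ht => ?_⟩)
    obtain ⟨u, rfl⟩ := exists_add_eq ht
    have := hN (N + u) (by
      change (N : ℝ≥0) ≤ N + u
      exact le_self_add)
    simpa only [Set.mem_preimage, ← add_assoc] using this
  · intro h
    refine h.comp (tendsto_atTop_mono (fun t => ?_) tendsto_id)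
    change (t : ℝ≥0) ≤ s + t
    exact le_add_self

instance : Countable TimeDomain.discrete.Time :=
  (Set.countable_range ((↑) : ℕ → ℝ≥0)).to_subtype

/-- Every time is a decreasing limit of times in a fixed countable set, in a measurable way. -/
theorem exists_right_approx (k : TimeDomain) : ∃ a : ℕ → k.Time → k.Time,
    (∀ n, Measurable (a n)) ∧ (∀ n, (Set.range (a n)).Countable) ∧
      ∀ t, Antitone (fun n => a n t) ∧ Tendsto (fun n => a n t) atTop (𝓝 t) := by
  cases k
  · exact ⟨fun _ t => t, fun _ => measurable_id, fun _ => Set.to_countable _,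
      fun t => ⟨antitone_const, tendsto_const_nhds⟩⟩
  -- Dyadic times just above `t`: adding one to the floor puts the approximation on the right of
  -- `t`, the side on which the flow is continuous.
  · let c : ℕ → ℕ → TimeDomain.continuous.Time :=
      fun n m => ⟨((m : ℝ≥0) + 1) / 2 ^ n, trivial⟩
    have hfl : ∀ (n : ℕ) (t : TimeDomain.continuous.Time),
        (⌊2 ^ n * (t : ℝ≥0)⌋₊ : ℝ≥0) ≤ 2 ^ n * t ∧
          2 ^ n * (t : ℝ≥0) < (⌊2 ^ n * (t : ℝ≥0)⌋₊ : ℝ≥0) + 1 := fun n t =>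
      ⟨Nat.floor_le (by positivity), Nat.lt_floor_add_one _⟩
    refine ⟨fun n t => c n ⌊2 ^ n * (t : ℝ≥0)⌋₊, fun n => ?_, fun n => ?_, fun t => ⟨?_, ?_⟩⟩
    · exact (measurable_from_nat (f := c n)).comp
        (Nat.measurable_floor.comp (measurable_subtype_coe.const_mul _))
    · exact (Set.countable_range (c n)).mono (Set.range_comp_subset_range _ (c n))
    · refine antitone_nat_of_succ_le fun n => ?_
      change ((⌊2 ^ (n + 1) * (t : ℝ≥0)⌋₊ : ℝ≥0) + 1) / 2 ^ (n + 1) ≤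
        ((⌊2 ^ n * (t : ℝ≥0)⌋₊ : ℝ≥0) + 1) / 2 ^ n
      have h : ⌊2 ^ (n + 1) * (t : ℝ≥0)⌋₊ + 1 ≤ 2 * (⌊2 ^ n * (t : ℝ≥0)⌋₊ + 1) := by
        rw [Nat.succ_le_iff, Nat.floor_lt (by positivity)]
        push_cast
        calc 2 ^ (n + 1) * (t : ℝ≥0) = 2 * (2 ^ n * t) := by ring
          _ < 2 * ((⌊2 ^ n * (t : ℝ≥0)⌋₊ : ℝ≥0) + 1) := by
              exact mul_lt_mul_of_pos_left (hfl n t).2 two_pos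
      have h' : (⌊2 ^ (n + 1) * (t : ℝ≥0)⌋₊ : ℝ≥0) + 1 ≤
          2 * ((⌊2 ^ n * (t : ℝ≥0)⌋₊ : ℝ≥0) + 1) := by exact_mod_cast h
      rw [pow_succ', div_le_div_iff₀ (by positivity) (by positivity)]
      calc _ ≤ 2 * ((⌊2 ^ n * (t : ℝ≥0)⌋₊ : ℝ≥0) + 1) * 2 ^ n := by gcongr; rwa [← pow_succ']
        _ = _ := by ring
    · rw [tendsto_subtype_rng]
      have hu : Tendsto (fun n : ℕ => (t : ℝ≥0) + (1 / 2 : ℝ≥0) ^ n) atTop (𝓝 (t : ℝ≥0)) := by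
        have := (tendsto_const_nhds (x := (t : ℝ≥0))).add
          (NNReal.tendsto_pow_atTop_nhds_zero_of_lt_one (r := 1 / 2) (by norm_num))
        simpa using this
      refine tendsto_of_tendsto_of_tendsto_of_le_of_le tendsto_const_nhds hu (fun n => ?_)
        fun n => ?_
      · change (t : ℝ≥0) ≤ ((⌊2 ^ n * (t : ℝ≥0)⌋₊ : ℝ≥0) + 1) / 2 ^ n
        rw [le_div_iff₀ (by positivity), mul_comm]
        exact (hfl n t).2.le
      · change ((⌊2 ^ n * (t : ℝ≥0)⌋₊ : ℝ≥0) + 1) / 2 ^ n ≤ (t : ℝ≥0) + (1 / 2 : ℝ≥0) ^ n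
        rw [div_le_iff₀ (by positivity), add_mul, ← mul_pow]
        have : (1 / 2 * 2 : ℝ≥0) = 1 := by norm_num
        rw [this, one_pow, mul_comm (t : ℝ≥0)]
        gcongr
        exact (hfl n t).1

/-! ### The measure on the set of times -/

theorem measurableEmbedding_coe_continuous :
    MeasurableEmbedding (fun t : TimeDomain.continuous.Time => ((t : ℝ≥0) : ℝ)) :=
  (MeasurableEmbedding.subtype_coe measurableSet_Ici).comp
    (MeasurableEmbedding.subtype_coe MeasurableSet.univ)

theorem timeMeasure_preimage_add (s : k.Time) {S : Set k.Time} (hS : MeasurableSet S) :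
    k.timeMeasure ((fun t => s + t) ⁻¹' S) = k.timeMeasure (S ∩ Set.Ici s) := by
  have himg : (fun t => s + t) '' ((fun t => s + t) ⁻¹' S) = S ∩ Set.Ici s := by
    rw [Set.image_preimage_eq_inter_range]
    congr 1
    ext t
    constructor
    · rintro ⟨u, rfl⟩
      change (s : ℝ≥0) ≤ s + u
      exact le_self_add
    · exact fun h => exists_add_eq h
  cases k
  · rw [← himg]
    exact (Measure.count_injective_image
      (fun a b h => Subtype.ext (add_left_cancel (congrArg Subtype.val h))) _).symm
  · rw [← himg]
    change Measure.comap _ _ _ = Measure.comap _ _ _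
    rw [measurableEmbedding_coe_continuous.comap_apply,
      measurableEmbedding_coe_continuous.comap_apply, Set.image_image]
    have : ∀ t : TimeDomain.continuous.Time, (((s + t : TimeDomain.continuous.Time) : ℝ≥0) : ℝ)
      = ((s : ℝ≥0) : ℝ) + ((t : ℝ≥0) : ℝ) := fun t => by push_cast; rfl
    simp only [this]
    rw [← Set.image_image (fun x : ℝ => ((s : ℝ≥0) : ℝ) + x)
      (fun t : TimeDomain.continuous.Time => ((t : ℝ≥0) : ℝ)), Set.image_add_left,
      measure_preimage_add]

theorem timeMeasure_lt_natTime (n : ℕ) : k.timeMeasure (Set.Iio (k.natTime n)) = n := by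
  cases k
  · have hinj : Function.Injective (natTime .discrete) := fun a b h => by
      have : (a : ℝ≥0) = b := congrArg Subtype.val h
      exact_mod_cast this
    have : Set.Iio (natTime .discrete n) = natTime .discrete '' (Set.Iio n) := by
      ext t
      constructor
      · obtain ⟨_, m, rfl⟩ := t
        intro h
        have h : ((m : ℕ) : ℝ≥0) < (n : ℝ≥0) := h
        exact ⟨m, by exact_mod_cast h, rfl⟩
      · rintro ⟨m, hm, rfl⟩
        change ((m : ℕ) : ℝ≥0) < (n : ℝ≥0)
        exact_mod_cast hm
    rw [this]
    change Measure.count _ = _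
    rw [Measure.count_injective_image hinj, Measure.count_apply_finite _ (Set.finite_Iio n)]
    simp
  · change Measure.comap _ _ _ = _
    rw [measurableEmbedding_coe_continuous.comap_apply]
    have : (fun t : TimeDomain.continuous.Time => ((t : ℝ≥0) : ℝ)) ''
        Set.Iio (natTime .continuous n) = Set.Ico 0 (n : ℝ) := by
      ext x
      constructor
      · rintro ⟨t, ht, rfl⟩
        refine ⟨NNReal.coe_nonneg _, ?_⟩
        have ht : (t : ℝ≥0) < (n : ℝ≥0) := ht
        exact_mod_cast ht
      · intro h
        refine ⟨⟨⟨x, h.1⟩, trivial⟩, ?_, rfl⟩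
        change (⟨x, h.1⟩ : ℝ≥0) < (n : ℝ≥0)
        exact_mod_cast h.2
    rw [this]
    simp

theorem timeMeasure_Ico (s : k.Time) (n : ℕ) :
    k.timeMeasure (Set.Ico s (s + k.natTime n)) = n := by
  have : (fun t => s + t) ⁻¹' (Set.Iio (s + k.natTime n)) = Set.Iio (k.natTime n) := by
    ext t
    change (s : ℝ≥0) + t < s + (n : ℝ≥0) ↔ (t : ℝ≥0) < n
    exact add_lt_add_iff_left _
  rw [← timeMeasure_lt_natTime (k := k) n, ← this, timeMeasure_preimage_add s measurableSet_Iio]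
  congr 1
  ext t
  exact and_comm

theorem map_add_timeMeasure (s : k.Time) :
    k.timeMeasure.map (fun t => s + t) = k.timeMeasure.restrict (Set.Ici s) := by
  ext S hS
  rw [Measure.map_apply (by fun_prop) hS, timeMeasure_preimage_add s hS, Measure.restrict_apply hS]

end TimeDomain

/-! ### Contracted sets -/

section Contraction

variable {k : TimeDomain} {Ω : Type*} {φ : k.Time → Ω → (Circ ≃ₜ Circ)}

/-- The length of the image of `S` tends to zero. -/
def IsContracted (φ : k.Time → Ω → (Circ ≃ₜ Circ)) (ω : Ω) (S : Set Circ) : Prop :=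
  Tendsto (fun t => volume (φ t ω '' S)) atTop (𝓝 0)

theorem IsContracted.mono {ω : Ω} {S T : Set Circ} (h : IsContracted φ ω T) (hST : S ⊆ T) :
    IsContracted φ ω S :=
  tendsto_of_tendsto_of_tendsto_of_le_of_le tendsto_const_nhds h (fun _ => zero_le)
    fun _ => measure_mono (Set.image_mono hST)

/-- The images still cover a circle of length one, so their finitely many lengths cannot all tend to
zero. -/
theorem not_forall_isContracted_of_cover {ω : Ω} {ι : Type*} (s : Finset ι) {B : ι → Set Circ}
    (hB : ⋃ i ∈ s, B i = Set.univ) : ¬ ∀ i ∈ s, IsContracted φ ω (B i) := by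
  intro h
  have h1 := tendsto_finsetSum s h
  have key : ∀ t, (1 : ℝ≥0∞) ≤ ∑ i ∈ s, volume (φ t ω '' B i) := by
    intro t
    refine le_trans ?_ (measure_biUnion_finset_le _ _)
    rw [← Set.image_iUnion₂, hB, Set.image_univ, (φ t ω).surjective.range_eq,
      UnitAddCircle.measure_univ]
  have := ge_of_tendsto' h1 key
  simp at this

theorem IsContracted.not_compl {ω : Ω} {S : Set Circ} (h : IsContracted φ ω S) :
    ¬ IsContracted φ ω Sᶜ := by
  intro h'
  refine not_forall_isContracted_of_cover (φ := φ) (ω := ω) Finset.univ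
    (B := fun b : Bool => if b then S else Sᶜ) ?_ ?_
  · ext z; by_cases hz : z ∈ S <;> simp [hz]
  · intro b _
    cases b
    · simpa using h'
    · simpa using h

theorem IsContracted.tendsto_dist {ω : Ω} {S : Set Circ} (h : IsContracted φ ω S)
    (hS : IsPreconnected S) (hm : MeasurableSet S) {x y : Circ} (hx : x ∈ S) (hy : y ∈ S) :
    Synced φ ω x y := by
  have h1 : ∀ t, ENNReal.ofReal (dist (φ t ω x) (φ t ω y)) ≤ volume (φ t ω '' S) := fun t =>
    Circ.dist_le_volume (hS.image _ (φ t ω).continuous.continuousOn)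
      ((φ t ω).measurableEmbedding.measurableSet_image.2 hm)
      (Set.mem_image_of_mem _ hx) (Set.mem_image_of_mem _ hy)
  have h2 := tendsto_of_tendsto_of_tendsto_of_le_of_le tendsto_const_nhds h (fun _ => zero_le) h1
  have h3 := (ENNReal.tendsto_toReal ENNReal.zero_ne_top).comp h2
  refine h3.congr fun t => ?_
  simp [ENNReal.toReal_ofReal dist_nonneg]

theorem Synced.symm {ω : Ω} {x y : Circ} (h : Synced φ ω x y) : Synced φ ω y x := by
  unfold Synced at *
  simpa only [dist_comm] using h

theorem Synced.trans {ω : Ω} {x y z : Circ} (h : Synced φ ω x y) (h' : Synced φ ω y z) :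
    Synced φ ω x z := by
  unfold Synced at *
  have := h.add h'
  rw [add_zero] at this
  exact squeeze_zero (fun _ => dist_nonneg) (fun t => dist_triangle _ _ _) this

theorem IsCrackPoint.synced {ω : Ω} {r x y : Circ} (h : IsCrackPoint φ ω r) (hx : x ≠ r)
    (hy : y ≠ r) : Synced φ ω x y := by
  obtain ⟨G, hG, hGc, hxG, hyG, hr⟩ := Circ.exists_arc hx hy
  exact IsContracted.tendsto_dist (h G hG hr) hGc hG.measurableSet hxG hyG

/-! ### Crack points -/

/-- The open complements of small closed balls around the points of a dense sequence. -/
noncomputable def coBall (j n : ℕ) : Set Circ :=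
  (Metric.closedBall (TopologicalSpace.denseSeq Circ j) (1 / ((n : ℝ) + 1)))ᶜ

theorem isOpen_coBall (j n : ℕ) : IsOpen (coBall j n) := Metric.isClosed_closedBall.isOpen_compl

theorem IsCrackPoint.isContracted_compl {ω : Ω} {r : Circ} (h : IsCrackPoint φ ω r) {U : Set Circ}
    (hU : IsOpen U) (hr : r ∈ U) : IsContracted φ ω Uᶜ :=
  h Uᶜ hU.isClosed_compl (by simpa using hr)

theorem IsCrackPoint.exists_coBall {ω : Ω} {r : Circ} (h : IsCrackPoint φ ω r) (n : ℕ) :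
    ∃ j, dist r (TopologicalSpace.denseSeq Circ j) < 1 / ((n : ℝ) + 1) ∧
      IsContracted φ ω (coBall j n) := by
  obtain ⟨j, hj⟩ := (TopologicalSpace.denseRange_denseSeq Circ).exists_dist_lt r
    (Nat.one_div_pos_of_nat (n := n) (α := ℝ))
  exact ⟨j, hj, (h.isContracted_compl Metric.isOpen_ball hj).mono
    (Set.compl_subset_compl.2 Metric.ball_subset_closedBall)⟩

/-- Replaces the quantifier over closed sets by countably many open sets, as measurability requires.
Conversely, closed balls with contracted complements have the finite intersection property, since
contracted sets cannot form a finite cover; by compactness they share a point, and it is the crack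
point. -/
theorem mem_contractiveSet_iff {ω : Ω} :
    ω ∈ contractiveSet φ ↔ ∀ n : ℕ, ∃ j : ℕ, IsContracted φ ω (coBall j n) := by
  constructor
  · rintro ⟨r, hr⟩ n
    obtain ⟨j, -, hj⟩ := hr.exists_coBall n
    exact ⟨j, hj⟩
  · intro h
    choose j hj using h
    obtain ⟨r, hr⟩ : (⋂ n, (coBall (j n) n)ᶜ).Nonempty := by
      refine CompactSpace.iInter_nonempty (fun n => (isOpen_coBall _ _).isClosed_compl) fun s => ?_
      by_contra hcon
      rw [Set.not_nonempty_iff_eq_empty] at hcon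
      refine not_forall_isContracted_of_cover (φ := φ) (ω := ω) s
        (B := fun n => coBall (j n) n) ?_ fun n _ => hj n
      rw [← compl_inj_iff, Set.compl_univ, ← hcon]
      simp
    refine ⟨r, fun G hG hrG => ?_⟩
    obtain ⟨ε, hε, hball⟩ := Metric.isOpen_iff.1 hG.isOpen_compl r hrG
    obtain ⟨n, hn⟩ := exists_nat_one_div_lt (half_pos hε)
    refine (hj n).mono fun z hz hzn => ?_
    have h1 := Set.mem_iInter.1 hr n
    simp only [coBall, compl_compl, Metric.mem_closedBall] at h1 hzn
    refine hball ?_ hz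
    have := dist_triangle_right z r (TopologicalSpace.denseSeq Circ (j n))
    rw [Metric.mem_ball]
    linarith

open Classical in
/-- The crack point, extended by `0` to the sample points that are not contractive. -/
noncomputable def crackFun (φ : k.Time → Ω → (Circ ≃ₜ Circ)) (ω : Ω) : Circ :=
  if h : ω ∈ contractiveSet φ then crackPoint φ ⟨ω, h⟩ else 0

theorem crackFun_eq {ω : Ω} (h : ω ∈ contractiveSet φ) : crackFun φ ω = crackPoint φ ⟨ω, h⟩ :=
  dif_pos h

theorem isCrackPoint_crackFun {ω : Ω} (h : ω ∈ contractiveSet φ) :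
    IsCrackPoint φ ω (crackFun φ ω) := by
  rw [crackFun_eq h]
  exact h.choose_spec

theorem crackEvent_eq (x : Circ) : crackEvent φ x = contractiveSet φ ∩ crackFun φ ⁻¹' {x} := by
  ext ω
  constructor
  · rintro ⟨h, hx⟩
    exact ⟨h, (crackFun_eq h).trans hx⟩
  · rintro ⟨h, hx⟩
    exact ⟨h, (crackFun_eq h).symm.trans hx⟩

end Contraction

/-! ### Measurability -/

theorem measurable_apply_right {α : Type*} [MeasurableSpace α] {g : α → Circ → Circ}
    (hg : Measurable fun p : α × Circ => g p.1 p.2) (x : Circ) : Measurable fun a => g a x :=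
  hg.comp measurable_prodMk_right

/-- The image of `K` is the closure of the image of a countable dense subset, so membership in it is
a countable condition, measurable jointly in the point and the noise. The length is then the measure
of a slice. -/
theorem measurable_volume_image_of_isClosed {α : Type*} [MeasurableSpace α]
    {f : α → (Circ ≃ₜ Circ)} (hf : Measurable fun p : α × Circ => f p.1 p.2) {K : Set Circ}
    (hK : IsClosed K) : Measurable fun ω => volume (f ω '' K) := by
  obtain ⟨D, hDK, hDc, hD⟩ :=
    (TopologicalSpace.IsSeparable.of_separableSpace K).exists_countable_dense_subset
  have hcl : closure D = K := (closure_minimal hDK hK).antisymm hD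
  have hmem : ∀ ω z, z ∈ f ω '' K ↔ ∀ n : ℕ, ∃ d ∈ D, dist z (f ω d) < 1 / ((n : ℝ) + 1) := by
    intro ω z
    rw [← hcl, (f ω).image_closure, Metric.mem_closure_iff]
    constructor
    · intro h n
      obtain ⟨_, ⟨d, hd, rfl⟩, h⟩ := h _ (Nat.one_div_pos_of_nat (n := n) (α := ℝ))
      exact ⟨d, hd, h⟩
    · intro h ε hε
      obtain ⟨n, hn⟩ := exists_nat_one_div_lt hε
      obtain ⟨d, hd, h⟩ := h n
      exact ⟨_, ⟨d, hd, rfl⟩, h.trans hn⟩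
  have hset : MeasurableSet {p : α × Circ | p.2 ∈ f p.1 '' K} := by
    simp only [hmem, Set.ofPred_forall]
    refine MeasurableSet.iInter fun n => ?_
    have : {p : α × Circ | ∃ d ∈ D, dist p.2 (f p.1 d) < 1 / ((n : ℝ) + 1)} =
        ⋃ d ∈ D, {p : α × Circ | dist p.2 (f p.1 d) < 1 / ((n : ℝ) + 1)} := by
      ext p; simp
    rw [this]
    refine MeasurableSet.biUnion hDc fun d _ => measurableSet_lt ?_ measurable_const
    exact measurable_snd.dist ((measurable_apply_right (g := fun a => f a) hf d).comp measurable_fst)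
  exact measurable_measure_prodMk_left hset

theorem measurable_volume_image_of_isOpen {α : Type*} [MeasurableSpace α]
    {f : α → (Circ ≃ₜ Circ)} (hf : Measurable fun p : α × Circ => f p.1 p.2) {U : Set Circ}
    (hU : IsOpen U) : Measurable fun ω => volume (f ω '' U) := by
  have h : (fun ω => volume (f ω '' U)) = fun ω => 1 - volume (f ω '' Uᶜ) := by
    ext ω
    rw [Set.image_compl_eq (f ω).bijective,
      measure_compl ((f ω).isOpenMap U hU).measurableSet (measure_ne_top _ _),
      UnitAddCircle.measure_univ, ENNReal.sub_sub_cancel ENNReal.one_ne_top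
        ((measure_mono (Set.subset_univ _)).trans UnitAddCircle.measure_univ.le)]
  rw [h]
  exact measurable_const.sub (measurable_volume_image_of_isClosed hf hU.isClosed_compl)

theorem measurable_indicator_const_one {α : Type*} {mα : MeasurableSpace α} {S : Set α}
    (hS : MeasurableSet S) : Measurable (S.indicator fun _ => (1 : ℝ≥0∞)) :=
  measurable_const.indicator hS

/-- The target `β` has its own σ-algebra, so that `Y` can be a shift and `Z` the identity, both into
`Ω` equipped with the coarser `futureSigma ℱ`, where independence is available. -/
theorem IndepFun.lintegral_comp_prod {Ω α β : Type*} {mΩ : MeasurableSpace Ω}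
    {mα : MeasurableSpace α} {mβ : MeasurableSpace β} {P : Measure Ω} [IsProbabilityMeasure P]
    {X : Ω → α} {Y Z : Ω → β} (hXY : IndepFun X Y P) (hX : Measurable X) (hY : Measurable Y)
    (hZ : Measurable Z) (hYZ : P.map Y = P.map Z) {G : α × β → ℝ≥0∞} (hG : Measurable G) :
    ∫⁻ ω, G (X ω, Y ω) ∂P = ∫⁻ ω, ∫⁻ ω', G (X ω, Z ω') ∂P ∂P := by
  have : IsProbabilityMeasure (P.map Z) := Measure.isProbabilityMeasure_map hZ.aemeasurable
  have h := (indepFun_iff_map_prod_eq_prod_map_map hX.aemeasurable hY.aemeasurable).1 hXY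
  rw [← lintegral_map hG (hX.prodMk hY), h, hYZ, lintegral_prod _ hG.aemeasurable,
    lintegral_map hG.lintegral_prod_right' hX]
  exact lintegral_congr fun ω => lintegral_map (hG.comp measurable_prodMk_left) hZ

theorem IndepFun.integral_comp_prod {Ω α β : Type*} {mΩ : MeasurableSpace Ω}
    {mα : MeasurableSpace α} {mβ : MeasurableSpace β} {P : Measure Ω} [IsProbabilityMeasure P]
    {X : Ω → α} {Y Z : Ω → β} (hXY : IndepFun X Y P) (hX : Measurable X) (hY : Measurable Y)
    (hZ : Measurable Z) (hYZ : P.map Y = P.map Z) {G : α × β → ℝ} (hG : Measurable G) {C : ℝ}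
    (hC : ∀ p, |G p| ≤ C) :
    ∫ ω, G (X ω, Y ω) ∂P = ∫ ω, ∫ ω', G (X ω, Z ω') ∂P ∂P := by
  have : IsProbabilityMeasure (P.map Z) := Measure.isProbabilityMeasure_map hZ.aemeasurable
  have : IsProbabilityMeasure (P.map X) := Measure.isProbabilityMeasure_map hX.aemeasurable
  have h := (indepFun_iff_map_prod_eq_prod_map_map hX.aemeasurable hY.aemeasurable).1 hXY
  have hIntg : Integrable G ((P.map X).prod (P.map Z)) :=
    Integrable.of_bound hG.aestronglyMeasurable C (Eventually.of_forall hC)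
  rw [← integral_map (hX.prodMk hY).aemeasurable hG.aestronglyMeasurable, h, hYZ,
    integral_prod _ hIntg, integral_map hX.aemeasurable
      hG.stronglyMeasurable.integral_prod_right'.aestronglyMeasurable]
  refine integral_congr_ae (Eventually.of_forall fun ω => ?_)
  exact integral_map hZ.aemeasurable (hG.comp measurable_prodMk_left).aestronglyMeasurable

section RDS

variable {k : TimeDomain} {Ω : Type*} [mΩ : MeasurableSpace Ω] {P : Measure Ω}
  {ℱ : Filtration k.Time mΩ} {θ : k.Time → Ω → Ω} {φ : k.Time → Ω → (Circ ≃ₜ Circ)}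

theorem isContracted_shift (hφ : IsRDS ℱ θ φ) (s : k.Time) (ω : Ω) (S : Set Circ) :
    IsContracted φ (θ s ω) (φ s ω '' S) ↔ IsContracted φ ω S := by
  unfold IsContracted
  rw [← TimeDomain.tendsto_add_atTop_iff (f := fun t => volume (φ t ω '' S)) s]
  simp only [Set.image_image, hφ.cocycle]

theorem IsRDS.measurable_apply (hφ : IsRDS ℱ θ φ) (t : k.Time) (x : Circ) :
    Measurable[ℱ t] fun ω => φ t ω x :=
  @measurable_apply_right Ω (ℱ t) _ (hφ.measurable t) x

theorem futureSigma_le (ℱ : Filtration k.Time mΩ) : futureSigma ℱ ≤ mΩ :=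
  iSup_le fun t => ℱ.le t

theorem le_futureSigma (ℱ : Filtration k.Time mΩ) (t : k.Time) : ℱ t ≤ futureSigma ℱ :=
  le_iSup (fun t => (ℱ t : MeasurableSpace Ω)) t

/-- Lower semicontinuity from the right: each point of `φ t ω '' U` eventually lies in the images at
times decreasing to `t`. Contraction can therefore be tested on a countable set of times. -/
theorem volume_image_le_of_antitone (hφ : IsRDS ℱ θ φ) {u : ℕ → k.Time} {t : k.Time}
    (hu : Antitone u) (hut : Tendsto u atTop (𝓝 t)) (ω : Ω) {U : Set Circ} (hU : IsOpen U)
    {c : ℝ≥0∞} (hc : ∀ n, volume (φ (u n) ω '' U) ≤ c) : volume (φ t ω '' U) ≤ c := by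
  have hsub : φ t ω '' U ⊆ ⋃ N : ℕ, ⋂ n ≥ N, φ (u n) ω '' U := by
    rintro _ ⟨x, hx, rfl⟩
    suffices h : ∀ᶠ n in atTop, φ t ω x ∈ φ (u n) ω '' U by
      obtain ⟨N, hN⟩ := eventually_atTop.1 h
      exact Set.mem_iUnion.2 ⟨N, Set.mem_iInter₂.2 hN⟩
    by_contra hcon
    obtain ⟨σ, hσ, hσU⟩ := extraction_of_frequently_atTop (not_eventually.1 hcon)
    -- If not, preimages stay in the closed complement of `U`; a limit point `y` of them satisfies
    -- `φ t ω y = φ t ω x` by joint right continuity, so `y = x`.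
    set z : ℕ → Circ := fun n => (φ (u (σ n)) ω).symm (φ t ω x) with hz
    have hzU : ∀ n, z n ∈ Uᶜ := fun n hn => hσU n ⟨z n, hn, by simp [hz]⟩
    obtain ⟨y, τ, hτ, hy⟩ := CompactSpace.tendsto_subseq z
    have hyU : y ∈ Uᶜ := hU.isClosed_compl.mem_of_tendsto hy (Eventually.of_forall fun n => hzU _)
    have h1 := hφ.right_continuous (fun n => u (σ (τ n))) t _ y
      (hu.comp_monotone (hσ.comp hτ).monotone)
      (hut.comp (hσ.comp hτ).tendsto_atTop) hy ω
    have h2 : (fun n => φ (u (σ (τ n))) ω ((z ∘ τ) n)) = fun _ => φ t ω x := by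
      ext n; simp [hz]
    rw [h2] at h1
    have := (φ t ω).injective (tendsto_nhds_unique tendsto_const_nhds h1)
    exact hyU (this ▸ hx)
  refine (measure_mono hsub).trans ?_
  have hmono : Monotone fun N : ℕ => ⋂ n ≥ N, φ (u n) ω '' U := fun a b hab =>
    Set.biInter_mono (fun n hn => le_trans hab hn) fun _ _ => le_rfl
  rw [hmono.measure_iUnion]
  exact iSup_le fun N => (measure_mono (Set.biInter_subset_of_mem (le_refl N))).trans (hc N)

theorem measurableSet_isContracted (hφ : IsRDS ℱ θ φ) {U : Set Circ} (hU : IsOpen U) :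
    MeasurableSet[futureSigma ℱ] {ω | IsContracted φ ω U} := by
  obtain ⟨a, -, hac, ha⟩ := k.exists_right_approx
  have hD : (⋃ n, Set.range (a n)).Countable := Set.countable_iUnion hac
  have : {ω | IsContracted φ ω U} = ⋂ m : ℕ, ⋃ N : ℕ, ⋂ d ∈ ⋃ n, Set.range (a n),
      {ω | k.natTime N ≤ d → volume (φ d ω '' U) ≤ ((m : ℝ≥0∞) + 1)⁻¹} := by
    ext ω
    simp only [Set.mem_ofPred_eq, Set.mem_iInter, Set.mem_iUnion, IsContracted,
      ENNReal.tendsto_atTop_zero]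
    constructor
    · intro h m
      obtain ⟨N, hN⟩ := h ((m : ℝ≥0∞) + 1)⁻¹ (by simp)
      obtain ⟨n, hn⟩ := TimeDomain.exists_natTime_ge N
      exact ⟨n, fun d _ hd => hN d (hn.trans hd)⟩
    · intro h ε hε
      obtain ⟨m, hm⟩ := ENNReal.exists_inv_nat_lt hε.ne'
      obtain ⟨N, hN⟩ := h m
      refine ⟨k.natTime N, fun t ht => ?_⟩
      refine (volume_image_le_of_antitone hφ (ha t).1 (ha t).2 ω hU fun n =>
        hN (a n t) ⟨n, t, rfl⟩ (ht.trans ((ha t).1.le_of_tendsto (ha t).2 n))).trans ?_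
      refine le_trans (ENNReal.inv_le_inv.2 ?_) hm.le
      exact le_self_add
  rw [this]
  refine MeasurableSet.iInter fun m => MeasurableSet.iUnion fun N =>
    MeasurableSet.biInter hD fun d _ => ?_
  by_cases hd : k.natTime N ≤ d
  · simp only [hd, true_imp_iff]
    exact le_futureSigma ℱ d _ (@measurable_volume_image_of_isOpen Ω (ℱ d) (φ d)
      (hφ.measurable d) U hU _ measurableSet_Iic)
  · simp [hd]

theorem measurableSet_contractiveSet (hφ : IsRDS ℱ θ φ) :
    MeasurableSet[futureSigma ℱ] (contractiveSet φ) := by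
  have : contractiveSet φ = ⋂ n : ℕ, ⋃ j : ℕ, {ω | IsContracted φ ω (coBall j n)} := by
    ext ω
    simp [mem_contractiveSet_iff]
  rw [this]
  exact MeasurableSet.iInter fun n => MeasurableSet.iUnion fun j =>
    measurableSet_isContracted hφ (isOpen_coBall j n)

theorem measurable_crackFun (hφ : IsRDS ℱ θ φ) : Measurable[futureSigma ℱ] (crackFun φ) := by
  have hc := measurableSet_contractiveSet hφ
  refine @measurable_of_isOpen _ _ _ _ _ (futureSigma ℱ) _ fun U hU => ?_
  set I : Set (ℕ × ℕ) := {p | (coBall p.1 p.2)ᶜ ⊆ U} with hI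
  -- The crack point lies in `U` exactly when some closed ball of the countable family lies inside
  -- `U` and has contracted complement. A crack point outside that ball would make the ball
  -- contracted too.
  have h1 : contractiveSet φ ∩ crackFun φ ⁻¹' U =
      contractiveSet φ ∩ ⋃ p ∈ I, {ω | IsContracted φ ω (coBall p.1 p.2)} := by
    ext ω
    refine and_congr_right fun hω => ?_
    have hr := isCrackPoint_crackFun hω
    simp only [Set.mem_iUnion, Set.mem_preimage, exists_prop, Set.mem_ofPred_eq]
    constructor
    · intro hU'
      obtain ⟨ε, hε, hball⟩ := Metric.isOpen_iff.1 hU _ hU'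
      obtain ⟨n, hn⟩ := exists_nat_one_div_lt (half_pos hε)
      obtain ⟨j, hj, hjc⟩ := hr.exists_coBall n
      refine ⟨(j, n), fun z hz => hball ?_, hjc⟩
      simp only [coBall, compl_compl, Metric.mem_closedBall] at hz
      have := dist_triangle_right z (crackFun φ ω) (TopologicalSpace.denseSeq Circ j)
      rw [Metric.mem_ball]
      linarith
    · rintro ⟨p, hp, hpc⟩
      by_contra hcon
      exact hpc.not_compl (hr.isContracted_compl (isOpen_coBall p.1 p.2)
        (by_contra fun h => hcon (hp h)))
  have h2 : crackFun φ ⁻¹' U = (contractiveSet φ ∩ crackFun φ ⁻¹' U) ∪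
      ((contractiveSet φ)ᶜ ∩ {_ω | (0 : Circ) ∈ U}) := by
    ext ω
    by_cases hω : ω ∈ contractiveSet φ
    · simp [hω]
    · simp [hω, crackFun]
  rw [h2, h1]
  refine (hc.inter (MeasurableSet.biUnion (Set.to_countable I) fun p _ =>
    measurableSet_isContracted hφ (isOpen_coBall _ _))).union (hc.compl.inter ?_)
  exact @MeasurableSet.const _ (futureSigma ℱ) _

theorem isCrackPoint_shift (hφ : IsRDS ℱ θ φ) (s : k.Time) (ω : Ω) (r : Circ) :
    IsCrackPoint φ (θ s ω) (φ s ω r) ↔ IsCrackPoint φ ω r := by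
  constructor
  · intro h G hG hr
    exact (isContracted_shift hφ s ω G).1 (h _ ((φ s ω).isClosedMap G hG)
      (by rwa [(φ s ω).injective.mem_set_image]))
  · intro h G hG hr
    have := (isContracted_shift hφ s ω (φ s ω ⁻¹' G)).2
      (h _ (hG.preimage (φ s ω).continuous) hr)
    rwa [Set.image_preimage_eq _ (φ s ω).surjective] at this

theorem mem_contractiveSet_shift (hφ : IsRDS ℱ θ φ) (s : k.Time) (ω : Ω) :
    θ s ω ∈ contractiveSet φ ↔ ω ∈ contractiveSet φ := by
  constructor
  · rintro ⟨r, hr⟩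
    refine ⟨(φ s ω).symm r, (isCrackPoint_shift hφ s ω _).1 ?_⟩
    simpa using hr
  · rintro ⟨r, hr⟩
    exact ⟨_, (isCrackPoint_shift hφ s ω _).2 hr⟩

theorem crackFun_shift (hφ : IsRDS ℱ θ φ) (s : k.Time) {ω : Ω} (hω : ω ∈ contractiveSet φ) :
    crackFun φ (θ s ω) = φ s ω (crackFun φ ω) :=
  (isCrackPoint_crackFun ((mem_contractiveSet_shift hφ s ω).2 hω)).unique
    ((isCrackPoint_shift hφ s ω _).2 (isCrackPoint_crackFun hω))

/-! ### Independence -/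

/-- An event independent of each `ℱ t` is independent of the σ-algebra they generate, to which it
belongs, hence of itself. -/
theorem measure_eq_zero_or_one_of_forall_indep [IsProbabilityMeasure P] {S : Set Ω}
    (hS : MeasurableSet[futureSigma ℱ] S)
    (h : ∀ t A, MeasurableSet[ℱ t] A → P (A ∩ S) = P A * P S) : P S = 0 ∨ P S = 1 := by
  have hS' : MeasurableSet S := futureSigma_le ℱ _ hS
  have hle : MeasurableSpace.generateFrom {S} ≤ mΩ :=
    MeasurableSpace.generateFrom_le (by rintro _ rfl; exact hS')
  have h1 : ∀ t, Indep (ℱ t) (MeasurableSpace.generateFrom {S}) P := by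
    intro t
    refine IndepSets.indep (ℱ.le t) hle (@MeasurableSpace.isPiSystem_measurableSet _ (ℱ t))
      (IsPiSystem.singleton S) (@MeasurableSpace.generateFrom_measurableSet _ (ℱ t)).symm rfl ?_
    rw [IndepSets_iff]
    rintro A _ hA rfl
    exact h t A hA
  have h2 : Indep (futureSigma ℱ) (MeasurableSpace.generateFrom {S}) P :=
    indep_iSup_of_monotone h1 (fun t => ℱ.le t) hle fun _ _ hst => ℱ.mono hst
  exact measure_eq_zero_or_one_of_indepSet_self
    (h2.indepSet_of_measurableSet hS (MeasurableSpace.measurableSet_generateFrom rfl))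

theorem IsNoise.map_eq (hθ : IsNoise P ℱ θ) (s : k.Time) :
    @Measure.map Ω Ω mΩ (futureSigma ℱ) (θ s) P = @Measure.map Ω Ω mΩ (futureSigma ℱ) id P := by
  have hsh : @Measurable Ω Ω mΩ (futureSigma ℱ) (θ s) :=
    (hθ.measurePreserving s).measurable.mono le_rfl (futureSigma_le ℱ)
  refine @Measure.ext _ (futureSigma ℱ) _ _ fun A hA => ?_
  rw [Measure.map_apply hsh hA, Measure.map_apply (measurable_id'' (futureSigma_le ℱ)) hA,
    (hθ.measurePreserving s).measure_preimage (futureSigma_le ℱ _ hA).nullMeasurableSet,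
    Set.preimage_id]

theorem IsNoise.indepFun (hθ : IsNoise P ℱ θ) (s : k.Time) {E : Type*} {mE : MeasurableSpace E}
    {X : Ω → E} (hX : Measurable[ℱ s] X) : @IndepFun Ω E Ω mΩ mE (futureSigma ℱ) X (θ s) P :=
  (@IndepFun_iff_Indep Ω E Ω mΩ mE (futureSigma ℱ) X (θ s) P).2
    (indep_of_indep_of_le_left (hθ.indep s) hX.comap_le)

/-- The Markov property, for nonnegative functionals. -/
theorem IsNoise.lintegral_shift (hθ : IsNoise P ℱ θ) [IsProbabilityMeasure P] (s : k.Time)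
    {E : Type*} {mE : MeasurableSpace E} {X : Ω → E} (hX : Measurable[ℱ s] X)
    {G : E × Ω → ℝ≥0∞} (hG : Measurable[mE.prod (futureSigma ℱ)] G) :
    ∫⁻ ω, G (X ω, θ s ω) ∂P = ∫⁻ ω, ∫⁻ ω', G (X ω, ω') ∂P ∂P :=
  IndepFun.lintegral_comp_prod (hθ.indepFun s hX) (hX.mono (ℱ.le s) le_rfl)
    ((hθ.measurePreserving s).measurable.mono le_rfl (futureSigma_le ℱ))
    (measurable_id'' (futureSigma_le ℱ)) (hθ.map_eq s) hG

/-- The Markov property, for bounded functionals. -/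
theorem IsNoise.integral_shift (hθ : IsNoise P ℱ θ) [IsProbabilityMeasure P] (s : k.Time)
    {E : Type*} {mE : MeasurableSpace E} {X : Ω → E} (hX : Measurable[ℱ s] X)
    {G : E × Ω → ℝ} (hG : Measurable[mE.prod (futureSigma ℱ)] G) {C : ℝ} (hC : ∀ p, |G p| ≤ C) :
    ∫ ω, G (X ω, θ s ω) ∂P = ∫ ω, ∫ ω', G (X ω, ω') ∂P ∂P :=
  IndepFun.integral_comp_prod (hθ.indepFun s hX) (hX.mono (ℱ.le s) le_rfl)
    ((hθ.measurePreserving s).measurable.mono le_rfl (futureSigma_le ℱ))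
    (measurable_id'' (futureSigma_le ℱ)) (hθ.map_eq s) hG hC

/-- The Markov property, for events. -/
theorem IsNoise.measure_shift (hθ : IsNoise P ℱ θ) [IsProbabilityMeasure P] (s : k.Time)
    {E : Type*} {mE : MeasurableSpace E} {X : Ω → E} (hX : Measurable[ℱ s] X)
    {S : Set (E × Ω)} (hS : MeasurableSet[mE.prod (futureSigma ℱ)] S) :
    P {ω | (X ω, θ s ω) ∈ S} = ∫⁻ ω, P {ω' | (X ω, ω') ∈ S} ∂P := by
  have hS' : MeasurableSet S :=
    (sup_le_sup le_rfl (MeasurableSpace.comap_mono (futureSigma_le ℱ)) :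
      mE.prod (futureSigma ℱ) ≤ mE.prod mΩ) _ hS
  have h := hθ.lintegral_shift s hX (G := S.indicator fun _ => 1)
    (measurable_indicator_const_one hS)
  have hX' := hX.mono (ℱ.le s) le_rfl
  have h1 : ∀ ω, ∫⁻ ω', S.indicator (fun _ => 1) (X ω, ω') ∂P = P {ω' | (X ω, ω') ∈ S} := fun ω =>
    lintegral_indicator_one (measurable_prodMk_left hS')
  have h2 : ∫⁻ ω, S.indicator (fun _ => 1) (X ω, θ s ω) ∂P = P {ω | (X ω, θ s ω) ∈ S} :=
    lintegral_indicator_one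
      ((hX'.prodMk (hθ.measurePreserving s).measurable) hS')
  rw [← h2, h]
  exact lintegral_congr h1

/-- The event is its own preimage under `θ t`, so it belongs to the σ-algebra that is independent of
`ℱ t`. -/
theorem contractiveSet_zero_one [IsProbabilityMeasure P] (hθ : IsNoise P ℱ θ)
    (hφ : IsRDS ℱ θ φ) : P (contractiveSet φ) = 0 ∨ P (contractiveSet φ) = 1 := by
  refine measure_eq_zero_or_one_of_forall_indep (measurableSet_contractiveSet hφ) fun t A hA => ?_
  refine (Indep_iff _ _ _).1 (hθ.indep t) A _ hA ⟨_, measurableSet_contractiveSet hφ, ?_⟩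
  ext ω
  exact mem_contractiveSet_shift hφ t ω

end RDS

/-! ### Atoms -/

theorem finite_setOf_le_measure_singleton (μ : Measure Circ) [IsFiniteMeasure μ] {ε : ℝ≥0∞}
    (hε : ε ≠ 0) : {y | ε ≤ μ {y}}.Finite :=
  Measure.finite_const_le_meas_of_disjoint_iUnion μ (pos_iff_ne_zero.2 hε)
    (fun _ => measurableSet_singleton _) (fun _ _ h => Set.disjoint_singleton.2 h)
    (measure_ne_top _ _)

/-- Only finitely many atoms are at least as heavy as a given one. -/
theorem exists_max_atom (μ : Measure Circ) [IsFiniteMeasure μ] {x : Circ} (hx : μ {x} ≠ 0) :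
    ∃ p, μ {p} ≠ 0 ∧ ∀ y, μ {y} ≤ μ {p} := by
  obtain ⟨p, hp, hmax⟩ := Set.exists_max_image _ (fun y => μ {y})
    (finite_setOf_le_measure_singleton μ hx) ⟨x, le_refl (μ {x})⟩
  refine ⟨p, ?_, fun y => ?_⟩
  · exact fun h => hx (le_antisymm (h ▸ hp) zero_le)
  · rcases le_total (μ {x}) (μ {y}) with h | h
    · exact hmax y h
    · exact h.trans hp

theorem measurable_measure_singleton (μ : Measure Circ) [IsFiniteMeasure μ] :
    Measurable fun y => μ {y} := by
  have h : MeasurableSet {p : Circ × Circ | p.2 = p.1} :=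
    measurableSet_eq_fun measurable_snd measurable_fst
  exact measurable_measure_prodMk_left h

section RDS

variable {k : TimeDomain} {Ω : Type*} [mΩ : MeasurableSpace Ω] {P : Measure Ω}
  {ℱ : Filtration k.Time mΩ} {θ : k.Time → Ω → Ω} {φ : k.Time → Ω → (Circ ≃ₜ Circ)}

/-- Right continuity reduces all times to countably many, so the exceptional null sets can be
united. -/
theorem isDetFixedPoint_of_forall (hφ : IsRDS ℱ θ φ) {p : Circ}
    (h : ∀ t, ∀ᵐ ω ∂P, φ t ω p = p) : IsDetFixedPoint P φ p := by
  obtain ⟨a, -, hac, ha⟩ := k.exists_right_approx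
  have hD : (⋃ n, Set.range (a n)).Countable := Set.countable_iUnion hac
  have := (ae_ball_iff hD).2 fun d _ => h d
  filter_upwards [this] with ω hω t
  have h1 := hφ.right_continuous _ t (fun _ => p) p (ha t).1 (ha t).2 tendsto_const_nhds ω
  have h2 : (fun n => φ (a n t) ω p) = fun _ => p :=
    funext fun n => hω _ (Set.mem_iUnion.2 ⟨n, t, rfl⟩)
  rw [h2] at h1
  exact tendsto_nhds_unique h1 tendsto_const_nhds

/-! ### The law of the crack point -/

/-- The `Prop` coordinate carries membership in an event of the past, so that this event and the
position form a single variable in the Markov property. -/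
theorem measurableSet_and_eq {β : Type*} [MeasurableSpace β] {R : β → Circ} (hR : Measurable R) :
    MeasurableSet {p : (Circ × Prop) × β | p.1.2 ∧ R p.2 = p.1.1} :=
  MeasurableSet.inter (measurableSet_setOfPred.2 (measurable_snd.comp measurable_fst))
    (measurableSet_eq_fun (hR.comp measurable_snd) (measurable_fst.comp measurable_fst))

theorem measurable_prodMk_mem {α β : Type*} {mα : MeasurableSpace α} [MeasurableSpace β]
    {f : α → β} (hf : Measurable f) {A : Set α} (hA : MeasurableSet A) :
    Measurable fun a => (f a, a ∈ A) :=
  hf.prodMk hA.mem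

theorem measurable_crackFun' (hφ : IsRDS ℱ θ φ) : Measurable (crackFun φ) :=
  (measurable_crackFun hφ).mono (futureSigma_le ℱ) le_rfl

theorem ae_mem_contractiveSet [IsProbabilityMeasure P] (hφ : IsRDS ℱ θ φ)
    (h : P (contractiveSet φ) = 1) : ∀ᵐ ω ∂P, ω ∈ contractiveSet φ :=
  (prob_compl_eq_zero_iff (futureSigma_le ℱ _ (measurableSet_contractiveSet hφ))).2 h

theorem measure_crackEvent [IsProbabilityMeasure P] (hφ : IsRDS ℱ θ φ)
    (h : P (contractiveSet φ) = 1) (x : Circ) :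
    P (crackEvent φ x) = P.map (crackFun φ) {x} := by
  rw [crackEvent_eq, Measure.map_apply (measurable_crackFun' hφ) (measurableSet_singleton x)]
  refine measure_congr ?_
  filter_upwards [ae_mem_contractiveSet hφ h] with ω hω
  exact propext ⟨fun h => h.2, fun h => ⟨hω, h⟩⟩

/-- Conditionally on the past up to time `s`, the crack point is `x` with the probability
that the law of the crack point gives to the image of `x` at time `s`. -/
theorem measure_inter_crackFun_eq [IsProbabilityMeasure P] (hθ : IsNoise P ℱ θ)
    (hφ : IsRDS ℱ θ φ) (h : P (contractiveSet φ) = 1) (x : Circ) (s : k.Time) {A : Set Ω}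
    (hA : MeasurableSet[ℱ s] A) :
    P (A ∩ crackFun φ ⁻¹' {x}) = ∫⁻ ω in A, P.map (crackFun φ) {φ s ω x} ∂P := by
  have hX : Measurable[ℱ s] fun ω => (φ s ω x, (ω ∈ A : Prop)) :=
    measurable_prodMk_mem (hφ.measurable_apply s x) hA
  have key := hθ.measure_shift s hX
    (@measurableSet_and_eq Ω (futureSigma ℱ) (crackFun φ) (measurable_crackFun hφ))
  simp only [Set.mem_ofPred_eq] at key
  have h1 : P (A ∩ crackFun φ ⁻¹' {x}) = P {ω | ω ∈ A ∧ crackFun φ (θ s ω) = φ s ω x} := by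
    refine measure_congr ?_
    filter_upwards [ae_mem_contractiveSet hφ h] with ω hω
    refine propext (and_congr_right fun _ => ?_)
    rw [crackFun_shift hφ s hω, (φ s ω).injective.eq_iff]
    rfl
  rw [h1, key, ← lintegral_indicator (ℱ.le s _ hA)]
  refine lintegral_congr fun ω => ?_
  by_cases hω : ω ∈ A
  · simp only [hω, true_and, Set.indicator_of_mem]
    rw [Measure.map_apply (measurable_crackFun' hφ) (measurableSet_singleton _)]
    rfl
  · simp [hω]

theorem crackPoint_dichotomy [IsProbabilityMeasure P] (hθ : IsNoise P ℱ θ)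
    (hφ : IsRDS ℱ θ φ) (h : P (contractiveSet φ) = 1) :
    (∀ x, P (crackEvent φ x) = 0) ∨
      (∃ p, IsDetFixedPoint P φ p ∧ ∀ᵐ ω ∂P, ω ∈ crackEvent φ p) := by
  by_cases hall : ∀ x, P (crackEvent φ x) = 0
  · exact Or.inl hall
  right
  push Not at hall
  obtain ⟨x, hx⟩ := hall
  rw [measure_crackEvent hφ h] at hx
  have hRm := measurable_crackFun' hφ
  set μ := P.map (crackFun φ) with hμ
  have : IsProbabilityMeasure μ := Measure.isProbabilityMeasure_map hRm.aemeasurable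
  obtain ⟨p, hp, hmax⟩ := exists_max_atom μ hx
  have hμp : μ {p} = P (crackFun φ ⁻¹' {p}) := Measure.map_apply hRm (measurableSet_singleton p)
  -- The mean of `μ {φ s ω p}` is `μ {p}`, which is also its maximum.
  have hconst : ∀ s, ∀ᵐ ω ∂P, μ {φ s ω p} = μ {p} := by
    intro s
    have h1 := measure_inter_crackFun_eq hθ hφ h p s
      (@MeasurableSet.univ _ (ℱ s))
    rw [Set.univ_inter, ← hμp, setLIntegral_univ] at h1
    have hm : Measurable fun ω => μ {φ s ω p} :=
      (measurable_measure_singleton μ).comp ((hφ.measurable_apply s p).mono (ℱ.le s) le_rfl)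
    refine ae_eq_of_ae_le_of_lintegral_le (Eventually.of_forall fun ω => hmax _) ?_
      aemeasurable_const ?_
    · rw [← h1]; exact measure_ne_top _ _
    · rw [← h1]; simp
  -- The conditional probability of this event given the past is now constant.
  have h01 : P (crackFun φ ⁻¹' {p}) = 0 ∨ P (crackFun φ ⁻¹' {p}) = 1 := by
    refine measure_eq_zero_or_one_of_forall_indep (ℱ := ℱ)
      (measurable_crackFun hφ (measurableSet_singleton p)) fun t A hA => ?_
    rw [measure_inter_crackFun_eq hθ hφ h p t hA,
      lintegral_congr_ae (ae_restrict_of_ae (hconst t)), ← hμp]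
    simp [mul_comm]
  have hone : μ {p} = 1 := by
    rw [hμp] at hp ⊢
    exact h01.resolve_left hp
  refine ⟨p, isDetFixedPoint_of_forall hφ fun t => ?_, ?_⟩
  · filter_upwards [hconst t] with ω hω
    -- Two distinct points cannot both have mass one.
    by_contra hne
    have h2 : μ ({φ t ω p} ∪ {p}) = 1 + 1 := by
      rw [measure_union (Set.disjoint_singleton.2 hne) (measurableSet_singleton _), hω, hone]
    have h3 : μ ({φ t ω p} ∪ {p}) ≤ 1 := prob_le_one
    rw [h2] at h3
    norm_num at h3
  · have hev : P (crackEvent φ p) = 1 := by rw [measure_crackEvent hφ h]; exact hone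
    have hms : MeasurableSet (crackEvent φ p) := by
      rw [crackEvent_eq]
      exact (futureSigma_le ℱ _ (measurableSet_contractiveSet hφ)).inter
        (hRm (measurableSet_singleton p))
    exact (prob_compl_eq_zero_iff hms).2 hev

/-! ### Stable synchronisation -/

theorem stablySynchronising_of_crackPoint [IsProbabilityMeasure P] (hφ : IsRDS ℱ θ φ)
    (h : P (contractiveSet φ) = 1) (ha : ∀ x, P (crackEvent φ x) = 0) :
    StablySynchronising P φ := by
  have hne : ∀ x, ∀ᵐ ω ∂P, ω ∈ contractiveSet φ ∧ x ≠ crackFun φ ω := by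
    intro x
    filter_upwards [ae_mem_contractiveSet hφ h, measure_eq_zero_iff_ae_notMem.1 (ha x)] with ω h1 h2
    refine ⟨h1, fun hx => h2 ?_⟩
    rw [crackEvent_eq]
    exact ⟨h1, hx.symm⟩
  refine ⟨fun x y => ?_, fun x => ?_⟩
  · filter_upwards [hne x, hne y] with ω hx hy
    exact (isCrackPoint_crackFun hx.1).synced hx.2 hy.2
  · filter_upwards [hne x] with ω hx
    have hd : 0 < dist (crackFun φ ω) x := dist_pos.2 hx.2.symm
    refine ⟨Metric.ball x (dist (crackFun φ ω) x / 2), Metric.isOpen_ball,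
      Metric.mem_ball_self (half_pos hd), ?_⟩
    have : IsContracted φ ω (Metric.closedBall x (dist (crackFun φ ω) x / 2)) :=
      isCrackPoint_crackFun hx.1 _ Metric.isClosed_closedBall (by
        rw [Metric.mem_closedBall]; linarith)
    exact this.mono Metric.ball_subset_closedBall

/-- As the radius shrinks, the events that the ball is not contracted decrease to a null set. -/
theorem EverywhereLocallyStable.exists_ball (hφ : IsRDS ℱ θ φ) [IsProbabilityMeasure P]
    (h : EverywhereLocallyStable P φ) (x : Circ) {ε : ℝ≥0∞} (hε : 0 < ε) :
    ∃ r > 0, P {ω | IsContracted φ ω (Metric.ball x r)}ᶜ < ε := by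
  have hm : ∀ r, MeasurableSet {ω | IsContracted φ ω (Metric.ball x r)} := fun r =>
    futureSigma_le ℱ _ (measurableSet_isContracted hφ Metric.isOpen_ball)
  set S : ℕ → Set Ω := fun n => {ω | IsContracted φ ω (Metric.ball x (1 / ((n : ℝ) + 1)))}ᶜ with hS
  have hanti : Antitone S := fun a b hab => Set.compl_subset_compl.2 fun ω hω =>
    IsContracted.mono hω (Metric.ball_subset_ball (one_div_le_one_div_of_le (by positivity)
      (by gcongr)))
  have hnull : P (⋂ n, S n) = 0 := by
    rw [measure_eq_zero_iff_ae_notMem]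
    filter_upwards [h x] with ω ⟨U, hU, hxU, hc⟩ hω
    obtain ⟨δ, hδ, hball⟩ := Metric.isOpen_iff.1 hU x hxU
    obtain ⟨n, hn⟩ := exists_nat_one_div_lt hδ
    exact Set.mem_iInter.1 hω n
      (IsContracted.mono (T := U) hc ((Metric.ball_subset_ball hn.le).trans hball))
  have ht := tendsto_measure_iInter_atTop (μ := P) (s := S)
    (fun n => (hm _).compl.nullMeasurableSet) hanti ⟨0, measure_ne_top _ _⟩
  rw [hnull] at ht
  obtain ⟨n, hn⟩ := (ht.eventually_lt_const hε).exists
  exact ⟨_, Nat.one_div_pos_of_nat, hn⟩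

theorem measurableSet_exists_pair {β ι : Type*} [MeasurableSpace β] (t : Finset ι)
    {V : ι → Set Circ} (hV : ∀ i, IsOpen (V i)) {C : ι → Set β} (hC : ∀ i, MeasurableSet (C i)) :
    MeasurableSet {p : (Circ × Circ) × β | ∃ i ∈ t, (p.1.1 ∈ V i ∧ p.1.2 ∈ V i) ∧ p.2 ∈ C i} := by
  have : {p : (Circ × Circ) × β | ∃ i ∈ t, (p.1.1 ∈ V i ∧ p.1.2 ∈ V i) ∧ p.2 ∈ C i} =
      ⋃ i ∈ t, ((V i ×ˢ V i) ×ˢ C i) := by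
    ext p
    simp only [Set.mem_ofPred_eq, Set.mem_iUnion, Set.mem_prod, exists_prop]
  rw [this]
  exact Finset.measurableSet_biUnion t fun i _ =>
    ((hV i).measurableSet.prod (hV i).measurableSet).prod (hC i)

/-- Under stable synchronisation, a set with at most two boundary points is contracted, or its
complement is. -/
theorem StablySynchronising.ae_isContracted_or [IsProbabilityMeasure P] (hθ : IsNoise P ℱ θ)
    (hφ : IsRDS ℱ θ φ) (h : StablySynchronising P φ) {B : Set Circ} {a b : Circ}
    (hB : frontier B ⊆ {a, b}) : ∀ᵐ ω ∂P, IsContracted φ ω B ∨ IsContracted φ ω Bᶜ := by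
  suffices hle : ∀ ε : ℝ≥0∞, 0 < ε →
      P {ω | ¬ (IsContracted φ ω B ∨ IsContracted φ ω Bᶜ)} ≤ ε + ε by
    refine le_antisymm (ENNReal.le_of_forall_pos_le_add fun ε hε _ => ?_) zero_le
    rw [zero_add]
    refine (hle (ε / 2 : ℝ≥0) (by simpa using hε.ne')).trans ?_
    rw [← ENNReal.coe_add, add_halves]
  intro ε hε
  -- Each ball fails to be contracted with probability below `ε`. Below the Lebesgue number `δ` of a
  -- finite subcover, two points share one of the balls.
  choose r hr hrP using fun x => h.2.exists_ball hφ x hε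
  obtain ⟨t, ht⟩ := isCompact_univ.elim_finite_subcover (fun x => Metric.ball x (r x))
    (fun x => Metric.isOpen_ball)
    (fun x _ => Set.mem_iUnion.2 ⟨x, Metric.mem_ball_self (hr x)⟩)
  obtain ⟨δ, hδ, hleb⟩ := lebesgue_number_lemma_of_metric (isCompact_univ (X := Circ))
    (c := fun x : t => Metric.ball (x : Circ) (r x)) (fun x => Metric.isOpen_ball) (by
      simpa [Set.iUnion_subtype] using ht)
  set C : Circ → Set Ω := fun x => {ω | IsContracted φ ω (Metric.ball x (r x))} with hC
  have hCm : ∀ x, MeasurableSet[futureSigma ℱ] (C x) := fun x =>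
    measurableSet_isContracted hφ Metric.isOpen_ball
  set S : Set ((Circ × Circ) × Ω) := {p | ∃ x ∈ t, (p.1.1 ∈ Metric.ball x (r x) ∧
    p.1.2 ∈ Metric.ball x (r x)) ∧ p.2 ∈ C x} with hS
  have hSm := @measurableSet_exists_pair Ω Circ (futureSigma ℱ) t
    (fun x => Metric.ball x (r x)) (fun x => Metric.isOpen_ball) C hCm
  -- Restart at time `s`. If the shifted noise contracts a ball containing the images of `a` and
  -- `b`, that ball contains the image of `B` or of its complement. Failure means that the two
  -- images are at least `δ` apart, or that the fresh noise spares their ball, which costs at most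
  -- `ε`.
  have hbound : ∀ s : k.Time, P {ω | ¬ (IsContracted φ ω B ∨ IsContracted φ ω Bᶜ)} ≤
      ε + P {ω | δ ≤ dist (φ s ω a) (φ s ω b)} := by
    intro s
    have hX : Measurable[ℱ s] fun ω => (φ s ω a, φ s ω b) :=
      (hφ.measurable_apply s a).prodMk (hφ.measurable_apply s b)
    have hX' := hX.mono (ℱ.le s) le_rfl
    have hdm : MeasurableSet {ω | δ ≤ dist (φ s ω a) (φ s ω b)} :=
      measurableSet_le measurable_const (hX'.fst.dist hX'.snd)
    calc P {ω | ¬ (IsContracted φ ω B ∨ IsContracted φ ω Bᶜ)}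
        ≤ P {ω | ((φ s ω a, φ s ω b), θ s ω) ∈ Sᶜ} := by
          refine measure_mono fun ω hω hmem => hω ?_
          obtain ⟨x, -, ⟨hax, hbx⟩, hc⟩ := hmem
          have hfr : frontier (φ s ω '' B) ⊆ Metric.ball x (r x) := by
            rw [← (φ s ω).image_frontier]
            rintro _ ⟨z, hz, rfl⟩
            rcases hB hz with rfl | hz
            · exact hax
            · rw [Set.mem_singleton_iff.1 hz]; exact hbx
          rcases Circ.subset_ball_or_compl_subset_ball hfr with h1 | h1
          · exact Or.inl ((isContracted_shift hφ s ω B).1 (IsContracted.mono hc h1))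
          · rw [← Set.image_compl_eq (φ s ω).bijective] at h1
            exact Or.inr ((isContracted_shift hφ s ω Bᶜ).1 (IsContracted.mono hc h1))
      _ = ∫⁻ ω, P {ω' | ((φ s ω a, φ s ω b), ω') ∈ Sᶜ} ∂P :=
          hθ.measure_shift s hX hSm.compl
      _ ≤ ∫⁻ ω, (ε + {ω | δ ≤ dist (φ s ω a) (φ s ω b)}.indicator 1 ω) ∂P := by
          refine lintegral_mono fun ω => ?_
          by_cases hd : δ ≤ dist (φ s ω a) (φ s ω b)
          · refine le_add_left ?_
            rw [Set.indicator_of_mem (by exact hd)]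
            exact prob_le_one
          · refine le_add_right ?_
            obtain ⟨x, hx⟩ := hleb (φ s ω a) trivial
            have hsub : {ω' | ((φ s ω a, φ s ω b), ω') ∈ Sᶜ} ⊆ (C x)ᶜ := fun ω' hω' hc => by
              refine (show ((φ s ω a, φ s ω b), ω') ∉ S from hω') ?_
              refine ⟨x, x.2, ⟨hx (Metric.mem_ball_self hδ), hx ?_⟩, hc⟩
              rw [Metric.mem_ball, dist_comm]
              exact not_le.1 hd
            exact (measure_mono hsub).trans (hrP x).le
      _ = ε + P {ω | δ ≤ dist (φ s ω a) (φ s ω b)} := by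
          rw [lintegral_add_left measurable_const, lintegral_indicator_one hdm]
          simp
  -- Synchronisation of `a` and `b` makes the second term small at a late integer time.
  have hmeas : TendstoInMeasure P (fun (n : ℕ) ω =>
      dist (φ (k.natTime n) ω a) (φ (k.natTime n) ω b)) atTop fun _ => 0 := by
    refine tendstoInMeasure_of_tendsto_ae (fun n => ?_) ?_
    · have h1 := (hφ.measurable_apply (k.natTime n) a).mono (ℱ.le _) le_rfl
      have h2 := (hφ.measurable_apply (k.natTime n) b).mono (ℱ.le _) le_rfl
      exact (h1.dist h2).aestronglyMeasurable
    · filter_upwards [h.1 a b] with ω hω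
      exact hω.comp TimeDomain.tendsto_natTime
  have ht0 := tendstoInMeasure_iff_dist.1 hmeas δ hδ
  obtain ⟨n, hn⟩ := (ht0.eventually_lt_const hε).exists
  refine (hbound (k.natTime n)).trans (add_le_add_right ?_ ε)
  refine le_trans (measure_mono fun ω hω => ?_) hn.le
  change δ ≤ dist (dist _ _) 0
  rw [Real.dist_0_eq_abs, abs_of_nonneg dist_nonneg]
  exact hω

/-- At each scale finitely many balls cover the circle, so some closed ball is not contracted; its
complement then is. -/
theorem StablySynchronising.contractiveSet_eq_one [IsProbabilityMeasure P] (hθ : IsNoise P ℱ θ)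
    (hφ : IsRDS ℱ θ φ) (h : StablySynchronising P φ) : P (contractiveSet φ) = 1 := by
  rw [← prob_compl_eq_zero_iff (futureSigma_le ℱ _ (measurableSet_contractiveSet hφ)),
    measure_eq_zero_iff_ae_notMem]
  have hall : ∀ᵐ ω ∂P, ∀ j n : ℕ, IsContracted φ ω (coBall j n)ᶜ ∨ IsContracted φ ω (coBall j n) := by
    refine ae_all_iff.2 fun j => ae_all_iff.2 fun n => ?_
    have := h.ae_isContracted_or hθ hφ (Circ.frontier_closedBall_subset
      (TopologicalSpace.denseSeq Circ j) (1 / ((n : ℝ) + 1)))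
    simpa only [coBall, compl_compl] using this
  filter_upwards [hall] with ω hω hcon
  refine hcon (mem_contractiveSet_iff.2 fun n => ?_)
  obtain ⟨t, ht⟩ := isCompact_univ.elim_finite_subcover
    (fun j => Metric.ball (TopologicalSpace.denseSeq Circ j) (1 / ((n : ℝ) + 1)))
    (fun j => Metric.isOpen_ball) (fun x _ => by
      obtain ⟨j, hj⟩ := (TopologicalSpace.denseRange_denseSeq Circ).exists_dist_lt x
        (Nat.one_div_pos_of_nat (n := n) (α := ℝ))
      exact Set.mem_iUnion.2 ⟨j, hj⟩)
  by_contra hno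
  push Not at hno
  refine not_forall_isContracted_of_cover (φ := φ) (ω := ω) t (B := fun j => (coBall j n)ᶜ) ?_
    fun j _ => (hω j n).resolve_right (hno j)
  refine Set.eq_univ_of_univ_subset (ht.trans (Set.iUnion₂_mono fun j _ => ?_))
  rw [coBall, compl_compl]
  exact Metric.ball_subset_closedBall

/-- A crack point fixed at `p` would contradict local stability at `p`: a neighbourhood of `p` and
its complement would both be contracted. -/
theorem StablySynchronising.crackEvent_eq_zero [IsProbabilityMeasure P] (hθ : IsNoise P ℱ θ)
    (hφ : IsRDS ℱ θ φ) (h : StablySynchronising P φ) (x : Circ) : P (crackEvent φ x) = 0 := by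
  refine (crackPoint_dichotomy hθ hφ (h.contractiveSet_eq_one hθ hφ)).resolve_right ?_ x
  rintro ⟨p, -, hp⟩
  obtain ⟨ω, hω, U, hU, hpU, hc⟩ := (hp.and (h.2 p)).exists
  obtain ⟨h1, rfl⟩ := hω
  have hcr : IsCrackPoint φ ω (crackPoint φ ⟨ω, h1⟩) := h1.choose_spec
  exact IsContracted.not_compl (S := U) hc (hcr.isContracted_compl hU hpU)

/-! ### Repulsion -/

/-- A Lebesgue number makes the radius uniform over the circle. -/
theorem exists_forall_measure_ball_lt (μ : Measure Circ) [IsFiniteMeasure μ]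
    (hμ : ∀ x, μ {x} = 0) {ε : ℝ≥0∞} (hε : 0 < ε) : ∃ δ > 0, ∀ x, μ (Metric.ball x δ) < ε := by
  have hloc : ∀ x, ∃ r > 0, μ (Metric.ball x r) < ε := by
    intro x
    obtain ⟨U, hxU, hU, hlt⟩ := Set.exists_isOpen_lt_of_lt {x} ε (by rwa [hμ x])
    obtain ⟨r, hr, hball⟩ := Metric.isOpen_iff.1 hU x (hxU rfl)
    exact ⟨r, hr, (measure_mono hball).trans_lt hlt⟩
  choose r hr hlt using hloc
  obtain ⟨δ, hδ, hleb⟩ := lebesgue_number_lemma_of_metric (isCompact_univ (X := Circ))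
    (c := fun x : Circ => Metric.ball x (r x)) (fun x => Metric.isOpen_ball)
    (fun x _ => Set.mem_iUnion.2 ⟨x, Metric.mem_ball_self (hr x)⟩)
  refine ⟨δ, hδ, fun x => ?_⟩
  obtain ⟨y, hy⟩ := hleb x trivial
  exact (measure_mono hy).trans_lt (hlt y)

theorem measurableSet_dist_lt {β : Type*} [MeasurableSpace β] {R : β → Circ} (hR : Measurable R)
    (δ : ℝ) : MeasurableSet {p : Circ × β | dist (R p.2) p.1 < δ} :=
  measurableSet_lt ((hR.comp measurable_snd).dist measurable_fst) measurable_const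

/-- At time `n` the crack point has moved to that of the shifted noise, which has the diffuse law
`μ` and is independent of `φ n ω y`. The event `A n` of proximity thus has probability at most `ε`,
while synchronisation would place `ω` in all `A n` from some `n` on. -/
theorem ae_not_synced_crackFun [IsProbabilityMeasure P] (hθ : IsNoise P ℱ θ)
    (hφ : IsRDS ℱ θ φ) (h : P (contractiveSet φ) = 1) (ha : ∀ x, P (crackEvent φ x) = 0)
    (y : Circ) : ∀ᵐ ω ∂P, ¬ Synced φ ω (crackFun φ ω) y := by
  have hRm := measurable_crackFun' hφ
  set μ := P.map (crackFun φ) with hμ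
  have : IsProbabilityMeasure μ := Measure.isProbabilityMeasure_map hRm.aemeasurable
  suffices hle : ∀ ε : ℝ≥0∞, 0 < ε → P {ω | ¬ ¬ Synced φ ω (crackFun φ ω) y} ≤ ε by
    exact le_antisymm (le_of_forall_gt fun ε hε => by
      obtain ⟨c, hc0, hc⟩ := exists_between hε
      exact (hle c hc0).trans_lt hc) zero_le
  intro ε hε
  obtain ⟨δ, hδ, hball⟩ := exists_forall_measure_ball_lt μ
    (fun x => by rw [← measure_crackEvent hφ h, ha x]) hε
  set A : ℕ → Set Ω := fun n => {ω | dist (crackFun φ (θ (k.natTime n) ω))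
    (φ (k.natTime n) ω y) < δ} with hA
  have hAle : ∀ n, P (A n) ≤ ε := by
    intro n
    have := hθ.measure_shift (k.natTime n) (hφ.measurable_apply (k.natTime n) y)
      (@measurableSet_dist_lt Ω (futureSigma ℱ) (crackFun φ) (measurable_crackFun hφ) δ)
    simp only [Set.mem_ofPred_eq] at this
    rw [hA]
    simp only
    rw [this]
    calc _ ≤ ∫⁻ _ω, ε ∂P := lintegral_mono fun ω => by
          have := hball (φ (k.natTime n) ω y)
          rw [hμ, Measure.map_apply hRm Metric.isOpen_ball.measurableSet] at this
          exact this.le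
      _ = ε := by simp
  have hsub : {ω | ¬ ¬ Synced φ ω (crackFun φ ω) y} ≤ᵐ[P] ⋃ N : ℕ, ⋂ n ≥ N, A n := by
    filter_upwards [ae_mem_contractiveSet hφ h] with ω hω hs
    have hs : Synced φ ω (crackFun φ ω) y := not_not.1 hs
    have := (hs.comp TimeDomain.tendsto_natTime).eventually_lt_const hδ
    obtain ⟨N, hN⟩ := eventually_atTop.1 this
    refine Set.mem_iUnion.2 ⟨N, Set.mem_iInter₂.2 fun n hn => ?_⟩
    change dist _ _ < δ
    rw [crackFun_shift hφ _ hω]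
    exact hN n hn
  refine (measure_mono_ae hsub).trans ?_
  have hmono : Monotone fun N : ℕ => ⋂ n ≥ N, A n := fun a b hab =>
    Set.biInter_mono (fun n hn => le_trans hab hn) fun _ _ => le_rfl
  rw [hmono.measure_iUnion]
  exact iSup_le fun N => (measure_mono (Set.biInter_subset_of_mem (le_refl N))).trans (hAle N)

theorem ae_isRepulsiveCrackPoint [IsProbabilityMeasure P] (hθ : IsNoise P ℱ θ)
    (hφ : IsRDS ℱ θ φ) (h : P (contractiveSet φ) = 1) (ha : ∀ x, P (crackEvent φ x) = 0) :
    ∀ᵐ ω ∂P, ∀ h : ω ∈ contractiveSet φ,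
      IsRepulsiveCrackPoint φ ω (crackPoint φ ⟨ω, h⟩) := by
  -- The point `0` is an arbitrary reference: all points off the crack point are synchronised with
  -- it, so one null set serves for every `y`.
  filter_upwards [ae_not_synced_crackFun hθ hφ h ha 0,
    measure_eq_zero_iff_ae_notMem.1 (ha 0)] with ω h1 h2 hω
  have hcr := isCrackPoint_crackFun hω
  rw [crackEvent_eq] at h2
  have h0 : (0 : Circ) ≠ crackFun φ ω := fun h => h2 ⟨hω, h.symm⟩
  rw [← crackFun_eq hω]
  have hnot : ∀ y, y ≠ crackFun φ ω → ¬ Synced φ ω (crackFun φ ω) y := fun y hy hs =>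
    h1 (hs.trans (hcr.synced hy h0))
  refine ⟨hcr, fun x y => ?_⟩
  by_cases hx : x = crackFun φ ω
  · subst hx
    by_cases hy : y = crackFun φ ω
    · subst hy
      simp [Synced]
    · simp [hy, hnot y hy]
  · by_cases hy : y = crackFun φ ω
    · subst hy
      simp only [hx, false_iff, not_true, iff_false]
      exact fun hs => hnot x hx hs.symm
    · simp [hx, hy, hcr.synced hx hy]

end RDS

/-! ### Stationary measures -/

section RDS

variable {k : TimeDomain} {Ω : Type*} [mΩ : MeasurableSpace Ω] {P : Measure Ω}
  {ℱ : Filtration k.Time mΩ} {θ : k.Time → Ω → Ω} {φ : k.Time → Ω → (Circ ≃ₜ Circ)}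

theorem abs_apply_le_norm (f : C(Circ, ℝ)) (x : Circ) : |f x| ≤ ‖f‖ := f.norm_coe_le_norm x

theorem IsRDS.measurable_apply' (hφ : IsRDS ℱ θ φ) (t : k.Time) (x : Circ) :
    Measurable fun ω => φ t ω x :=
  (hφ.measurable_apply t x).mono (ℱ.le t) le_rfl

theorem IsRDS.measurable_future (hφ : IsRDS ℱ θ φ) (t : k.Time) :
    Measurable[(futureSigma ℱ).prod (inferInstance : MeasurableSpace Circ)]
      (fun p : Ω × Circ => φ t p.1 p.2) :=
  (hφ.measurable t).mono (sup_le_sup (MeasurableSpace.comap_mono (le_futureSigma ℱ t)) le_rfl)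
    le_rfl

theorem IsRDS.measurable_uncurry (hφ : IsRDS ℱ θ φ) (t : k.Time) :
    Measurable (fun p : Ω × Circ => φ t p.1 p.2) :=
  (hφ.measurable t).mono (sup_le_sup (MeasurableSpace.comap_mono (ℱ.le t)) le_rfl) le_rfl

/-- The expectation of `f` at time `t` along the trajectory of `x`, as a function of `x`. -/
noncomputable def transitionOp [IsProbabilityMeasure P] (hφ : IsRDS ℱ θ φ) (t : k.Time)
    (f : C(Circ, ℝ)) : C(Circ, ℝ) where
  toFun x := ∫ ω, f (φ t ω x) ∂P
  continuous_toFun := continuous_of_dominated (bound := fun _ => ‖f‖)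
    (fun x => (f.continuous.measurable.comp (hφ.measurable_apply' t x)).aestronglyMeasurable)
    (fun _ => Eventually.of_forall fun _ => abs_apply_le_norm f _) (integrable_const _)
    (Eventually.of_forall fun ω => f.continuous.comp (φ t ω).continuous)

theorem transitionOp_apply [IsProbabilityMeasure P] (hφ : IsRDS ℱ θ φ) (t : k.Time)
    (f : C(Circ, ℝ)) (x : Circ) : transitionOp (P := P) hφ t f x = ∫ ω, f (φ t ω x) ∂P := rfl

theorem integrable_apply [IsProbabilityMeasure P] (hφ : IsRDS ℱ θ φ) (t : k.Time)
    (f : C(Circ, ℝ)) (x : Circ) : Integrable (fun ω => f (φ t ω x)) P :=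
  Integrable.of_bound
    (f.continuous.measurable.comp (hφ.measurable_apply' t x)).aestronglyMeasurable ‖f‖
    (Eventually.of_forall fun _ => abs_apply_le_norm f _)

theorem abs_transitionOp_le [IsProbabilityMeasure P] (hφ : IsRDS ℱ θ φ) (t : k.Time)
    (f : C(Circ, ℝ)) (x : Circ) : |transitionOp (P := P) hφ t f x| ≤ ‖f‖ := by
  have := norm_integral_le_of_norm_le_const (μ := P) (f := fun ω => f (φ t ω x)) (C := ‖f‖)
    (Eventually.of_forall fun _ => abs_apply_le_norm f _)
  simpa [transitionOp_apply] using this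

theorem abs_clamp_le {M : ℝ} (hM : 0 ≤ M) (a : ℝ) : |max (-M) (min a M)| ≤ M :=
  abs_le.2 ⟨le_max_left _ _, max_le (by linarith) (min_le_right _ _)⟩

/-- Clamping makes the functional bounded on the whole product space, as `IsNoise.integral_shift`
demands, and changes nothing at weights bounded by `M`. -/
theorem measurable_clamp_mul {β : Type*} [MeasurableSpace β] {g : β → Circ → Circ}
    (hg : Measurable fun p : β × Circ => g p.1 p.2) (f : C(Circ, ℝ)) (M : ℝ) :
    Measurable fun p : (Circ × ℝ) × β => max (-M) (min p.1.2 M) * f (g p.2 p.1.1) := by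
  have h1 : Measurable fun p : (Circ × ℝ) × β => g p.2 p.1.1 :=
    hg.comp (measurable_snd.prodMk (measurable_fst.comp measurable_fst))
  have h2 : Measurable fun p : (Circ × ℝ) × β => p.1.2 := measurable_snd.comp measurable_fst
  exact (measurable_const.max (h2.min measurable_const)).mul (f.continuous.measurable.comp h1)

/-- The Markov property of the trajectory of `x`, tested against a bounded weight depending on
the past. -/
theorem integral_mul_apply_add [IsProbabilityMeasure P] (hθ : IsNoise P ℱ θ) (hφ : IsRDS ℱ θ φ)
    (s t : k.Time) (f : C(Circ, ℝ)) (x : Circ) {W : Ω → ℝ} (hW : Measurable[ℱ s] W) {M : ℝ}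
    (hM : ∀ ω, |W ω| ≤ M) :
    ∫ ω, W ω * f (φ (s + t) ω x) ∂P = ∫ ω, W ω * transitionOp (P := P) hφ t f (φ s ω x) ∂P := by
  rcases isEmpty_or_nonempty Ω with hΩ | ⟨⟨ω₀⟩⟩
  · simp [Measure.eq_zero_of_isEmpty P]
  have hM0 : 0 ≤ M := (abs_nonneg _).trans (hM ω₀)
  have hcl : ∀ ω, max (-M) (min (W ω) M) = W ω := fun ω => by
    have := abs_le.1 (hM ω)
    rw [min_eq_left this.2, max_eq_right this.1]
  have key := hθ.integral_shift s ((hφ.measurable_apply s x).prodMk hW)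
    (@measurable_clamp_mul Ω (futureSigma ℱ) (fun ω => φ t ω) (hφ.measurable_future t) f M)
    (C := M * ‖f‖) (fun p => by
      rw [abs_mul]
      exact mul_le_mul (abs_clamp_le hM0 _) (abs_apply_le_norm f _) (abs_nonneg _) hM0)
  simp only [hcl, ← hφ.cocycle] at key
  rw [key]
  refine integral_congr_ae (Eventually.of_forall fun ω => ?_)
  exact integral_const_mul _ _

theorem transitionOp_add [IsProbabilityMeasure P] (hθ : IsNoise P ℱ θ) (hφ : IsRDS ℱ θ φ)
    (s t : k.Time) (f : C(Circ, ℝ)) (x : Circ) :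
    transitionOp (P := P) hφ (s + t) f x =
      ∫ ω, transitionOp (P := P) hφ t f (φ s ω x) ∂P := by
  have := integral_mul_apply_add hθ hφ s t f x (W := fun _ => 1)
    (@measurable_const _ _ _ (ℱ s) _) (M := 1) (by simp)
  simp only [one_mul] at this
  exact this

theorem tendsto_sub_of_tendsto_dist (f : C(Circ, ℝ)) {ι : Type*} {l : Filter ι} {x y : ι → Circ}
    (h : Tendsto (fun j => dist (x j) (y j)) l (𝓝 0)) :
    Tendsto (fun j => f (x j) - f (y j)) l (𝓝 0) := by
  have huc : UniformContinuous f := CompactSpace.uniformContinuous_of_continuous f.continuous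
  rw [Metric.tendsto_nhds]
  intro ε hε
  obtain ⟨δ, hδ, hf⟩ := Metric.uniformContinuous_iff.1 huc ε hε
  filter_upwards [h.eventually_lt_const hδ] with j hj
  rw [dist_zero_right, ← dist_eq_norm]
  exact hf hj

/-- The initial points may vary with `j`; uniform convergence by compactness will need this. -/
theorem tendsto_transitionOp_sub [IsProbabilityMeasure P] (hφ : IsRDS ℱ θ φ) (f : C(Circ, ℝ))
    {u : ℕ → k.Time} {x y : ℕ → Circ}
    (h : ∀ᵐ ω ∂P, Tendsto (fun j => dist (φ (u j) ω (x j)) (φ (u j) ω (y j))) atTop (𝓝 0)) :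
    Tendsto (fun j => transitionOp (P := P) hφ (u j) f (x j) -
      transitionOp (P := P) hφ (u j) f (y j)) atTop (𝓝 0) := by
  have h1 : Tendsto (fun j => ∫ ω, (f (φ (u j) ω (x j)) - f (φ (u j) ω (y j))) ∂P) atTop
      (𝓝 (∫ _ω, (0 : ℝ) ∂P)) := by
    refine tendsto_integral_of_dominated_convergence (fun _ => ‖f‖ + ‖f‖) (fun j => ?_)
      (integrable_const _) (fun j => Eventually.of_forall fun ω => ?_) ?_
    · exact ((integrable_apply hφ (u j) f (x j)).sub
        (integrable_apply hφ (u j) f (y j))).aestronglyMeasurable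
    · exact (abs_sub _ _).trans
        (add_le_add (abs_apply_le_norm f _) (abs_apply_le_norm f _))
    · filter_upwards [h] with ω hω
      exact tendsto_sub_of_tendsto_dist f hω
  rw [integral_zero] at h1
  refine h1.congr fun j => ?_
  rw [integral_sub (integrable_apply hφ _ f _) (integrable_apply hφ _ f _)]
  rfl

theorem Synchronising.tendsto_transitionOp_sub [IsProbabilityMeasure P] (hφ : IsRDS ℱ θ φ)
    (h : Synchronising P φ) (f : C(Circ, ℝ)) (x y : Circ) :
    Tendsto (fun n => transitionOp (P := P) hφ (k.natTime n) f x -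
      transitionOp (P := P) hφ (k.natTime n) f y) atTop (𝓝 0) := by
  refine _root_.tendsto_transitionOp_sub hφ f (x := fun _ => x) (y := fun _ => y) ?_
  filter_upwards [h x y] with ω hω
  exact hω.comp TimeDomain.tendsto_natTime

theorem isStationaryMeasure_iff [IsProbabilityMeasure P] (hφ : IsRDS ℱ θ φ) {ρ : Measure Circ}
    [IsProbabilityMeasure ρ] : IsStationaryMeasure P φ ρ ↔
      ∀ t, (P.prod ρ).map (fun p => φ t p.1 p.2) = ρ := by
  have hval : ∀ t A, MeasurableSet A → (P.prod ρ).map (fun p => φ t p.1 p.2) A =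
      ∫⁻ x, P {ω | φ t ω x ∈ A} ∂ρ := by
    intro t A hA
    rw [Measure.map_apply (hφ.measurable_uncurry t) hA,
      Measure.prod_apply_symm (hφ.measurable_uncurry t hA)]
    rfl
  constructor
  · intro h t
    ext A hA
    rw [hval t A hA, h.2 t A hA]
  · intro h
    refine ⟨inferInstance, fun t A hA => ?_⟩
    rw [← hval t A hA, h t]

theorem integral_map_uncurry [IsProbabilityMeasure P] (hφ : IsRDS ℱ θ φ) (ρ : Measure Circ)
    [IsProbabilityMeasure ρ] (t : k.Time) (f : C(Circ, ℝ)) :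
    ∫ x, f x ∂((P.prod ρ).map fun p => φ t p.1 p.2) = ∫ x, transitionOp (P := P) hφ t f x ∂ρ := by
  have hm := hφ.measurable_uncurry t
  rw [integral_map hm.aemeasurable f.continuous.aestronglyMeasurable, integral_prod_symm]
  · rfl
  · exact Integrable.of_bound (f.continuous.measurable.comp hm).aestronglyMeasurable ‖f‖
      (Eventually.of_forall fun _ => abs_apply_le_norm f _)

theorem IsStationaryMeasure.integral_transitionOp [IsProbabilityMeasure P] (hφ : IsRDS ℱ θ φ)
    {ρ : Measure Circ} (h : IsStationaryMeasure P φ ρ) (t : k.Time) (f : C(Circ, ℝ)) :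
    ∫ x, transitionOp (P := P) hφ t f x ∂ρ = ∫ x, f x ∂ρ := by
  have := h.1
  rw [← integral_map_uncurry hφ ρ t f, (isStationaryMeasure_iff hφ).1 h t]

theorem measure_eq_of_forall_integral_eq {μ ν : Measure Circ} [IsFiniteMeasure μ]
    [IsFiniteMeasure ν] (h : ∀ f : C(Circ, ℝ), ∫ x, f x ∂μ = ∫ x, f x ∂ν) : μ = ν :=
  ext_of_forall_integral_eq_of_IsFiniteMeasure fun f => h f.toContinuousMap

/-- The laws of the trajectory of `0` at integer times have a limit along an ultrafilter, by
compactness. It is stationary because running for `t` first only changes the initial point from `0`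
to `φ t ω 0`, which synchronisation forgets. -/
theorem Synchronising.exists_isStationaryMeasure [IsProbabilityMeasure P] (hθ : IsNoise P ℱ θ)
    (hφ : IsRDS ℱ θ φ) (h : Synchronising P φ) : ∃ ρ, IsStationaryMeasure P φ ρ := by
  let μ : ℕ → ProbabilityMeasure Circ := fun n =>
    ⟨P.map fun ω => φ (k.natTime n) ω 0,
      Measure.isProbabilityMeasure_map (hφ.measurable_apply' _ _).aemeasurable⟩
  have hμ : ∀ n (f : C(Circ, ℝ)), ∫ x, f x ∂(μ n : Measure Circ) =
      ∫ ω, f (φ (k.natTime n) ω 0) ∂P := fun n f =>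
    integral_map (hφ.measurable_apply' _ _).aemeasurable f.continuous.aestronglyMeasurable
  let U : Ultrafilter ℕ := hyperfilter ℕ
  have hU : (U : Filter ℕ) ≤ atTop := by
    rw [← Nat.cofinite_eq_atTop]
    exact hyperfilter_le_cofinite
  let ρ : ProbabilityMeasure Circ := (U.map μ).lim
  have hρ : Tendsto μ U (𝓝 ρ) := (U.map μ).le_nhds_lim
  have hIntg : ∀ f : C(Circ, ℝ), Tendsto (fun n => ∫ ω, f (φ (k.natTime n) ω 0) ∂P) U
      (𝓝 (∫ x, f x ∂(ρ : Measure Circ))) := by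
    intro f
    have := (ProbabilityMeasure.tendsto_iff_forall_integral_tendsto.1 hρ)
      (BoundedContinuousFunction.mkOfCompact f)
    simp only [BoundedContinuousFunction.mkOfCompact_apply, hμ] at this
    exact this
  refine ⟨ρ, (isStationaryMeasure_iff hφ).2 fun t => ?_⟩
  have : IsProbabilityMeasure ((P.prod (ρ : Measure Circ)).map fun p => φ t p.1 p.2) :=
    Measure.isProbabilityMeasure_map (hφ.measurable_uncurry t).aemeasurable
  refine measure_eq_of_forall_integral_eq fun f => ?_
  rw [integral_map_uncurry hφ]
  have h1 := (hIntg (transitionOp (P := P) hφ t f)).sub (hIntg f)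
  have h2 : Tendsto (fun n => ∫ ω, (transitionOp (P := P) hφ (k.natTime n) f (φ t ω 0) -
      transitionOp (P := P) hφ (k.natTime n) f 0) ∂P) atTop (𝓝 (∫ _ω, (0 : ℝ) ∂P)) := by
    refine tendsto_integral_of_dominated_convergence (fun _ => ‖f‖ + ‖f‖) (fun n => ?_)
      (integrable_const _) (fun n => Eventually.of_forall fun ω => ?_)
      (Eventually.of_forall fun ω => h.tendsto_transitionOp_sub hφ f _ _)
    · exact ((integrable_apply hφ t (transitionOp (P := P) hφ (k.natTime n) f) 0).sub
        (integrable_const _)).aestronglyMeasurable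
    · exact (norm_sub_le _ _).trans
        (add_le_add (abs_transitionOp_le hφ _ f _) (abs_transitionOp_le hφ _ f _))
  rw [integral_zero] at h2
  refine sub_eq_zero.1 (tendsto_nhds_unique h1 ((h2.mono_left hU).congr fun n => ?_))
  rw [integral_sub (integrable_apply hφ t _ 0) (integrable_const _), ← transitionOp_add hθ hφ,
    ← transitionOp_add hθ hφ, add_comm]
  simp [transitionOp_apply]

/-- By stationarity the limit is the `ρ`-average of the same expectation over initial points `y`,
and each difference between `x` and `y` vanishes. -/
theorem Synchronising.tendsto_transitionOp [IsProbabilityMeasure P] (hφ : IsRDS ℱ θ φ)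
    (h : Synchronising P φ) {ρ : Measure Circ} (hρ : IsStationaryMeasure P φ ρ) (f : C(Circ, ℝ))
    (x : Circ) : Tendsto (fun n => transitionOp (P := P) hφ (k.natTime n) f x) atTop
      (𝓝 (∫ y, f y ∂ρ)) := by
  have := hρ.1
  have hi : ∀ g : C(Circ, ℝ), Integrable g ρ := fun g =>
    Integrable.of_bound g.continuous.aestronglyMeasurable ‖g‖
      (Eventually.of_forall (abs_apply_le_norm g))
  have h2 : Tendsto (fun n => ∫ y, (transitionOp (P := P) hφ (k.natTime n) f x -
      transitionOp (P := P) hφ (k.natTime n) f y) ∂ρ) atTop (𝓝 (∫ _y, (0 : ℝ) ∂ρ)) := by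
    refine tendsto_integral_of_dominated_convergence (fun _ => ‖f‖ + ‖f‖) (fun n => ?_)
      (integrable_const _) (fun n => Eventually.of_forall fun ω => ?_)
      (Eventually.of_forall fun ω => h.tendsto_transitionOp_sub hφ f _ _)
    · exact ((integrable_const _).sub (hi _)).aestronglyMeasurable
    · exact (norm_sub_le _ _).trans
        (add_le_add (abs_transitionOp_le hφ _ f _) (abs_transitionOp_le hφ _ f _))
  rw [integral_zero] at h2
  rw [tendsto_iff_norm_sub_tendsto_zero]
  refine (h2.norm.congr fun n => ?_).trans (by simp)
  rw [integral_sub (integrable_const _) (hi _), hρ.integral_transitionOp hφ]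
  simp

theorem Synchronising.stationary_unique [IsProbabilityMeasure P] (hφ : IsRDS ℱ θ φ)
    (h : Synchronising P φ) {ρ ρ' : Measure Circ} (hρ : IsStationaryMeasure P φ ρ)
    (hρ' : IsStationaryMeasure P φ ρ') : ρ' = ρ := by
  have := hρ.1
  have := hρ'.1
  exact measure_eq_of_forall_integral_eq fun f =>
    tendsto_nhds_unique (h.tendsto_transitionOp hφ hρ' f 0) (h.tendsto_transitionOp hφ hρ f 0)

/-- Under stable synchronisation the transition probabilities converge uniformly. -/
theorem StablySynchronising.exists_abs_transitionOp_sub_le [IsProbabilityMeasure P]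
    (hφ : IsRDS ℱ θ φ) (h : StablySynchronising P φ) {ρ : Measure Circ}
    (hρ : IsStationaryMeasure P φ ρ) (f : C(Circ, ℝ)) {ε : ℝ} (hε : 0 < ε) :
    ∃ n : ℕ, ∀ x, |transitionOp (P := P) hφ (k.natTime n) f x - ∫ y, f y ∂ρ| < ε := by
  by_contra hcon
  push Not at hcon
  choose x hx using hcon
  -- Points of failure accumulate at some `y`. A neighbourhood of `y` is contracted, so at time `σ
  -- j` the trajectories of `x (σ j)` and `y` are close.
  obtain ⟨y, σ, hσ, hy⟩ := CompactSpace.tendsto_subseq x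
  have hsub := tendsto_transitionOp_sub (P := P) hφ f (u := fun j => k.natTime (σ j))
    (x := fun j => x (σ j)) (y := fun _ => y) (by
      filter_upwards [h.2 y] with ω ⟨U, hU, hyU, hc⟩
      obtain ⟨r, hr, hball⟩ := Metric.isOpen_iff.1 hU y hyU
      have hc : IsContracted φ ω (Metric.ball y r) := IsContracted.mono (T := U) hc hball
      have hnat := hc.comp (TimeDomain.tendsto_natTime.comp hσ.tendsto_atTop)
      have hreal := (ENNReal.tendsto_toReal ENNReal.zero_ne_top).comp hnat
      refine squeeze_zero' (Eventually.of_forall fun _ => dist_nonneg) ?_ hreal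
      filter_upwards [hy.eventually (Metric.ball_mem_nhds y hr)] with j hj
      have := Circ.dist_le_volume
        ((Circ.isPreconnected_ball y r).image _ (φ (k.natTime (σ j)) ω).continuous.continuousOn)
        ((φ (k.natTime (σ j)) ω).measurableEmbedding.measurableSet_image.2
          Metric.isOpen_ball.measurableSet)
        (Set.mem_image_of_mem _ hj) (Set.mem_image_of_mem _ (Metric.mem_ball_self hr))
      exact (ENNReal.ofReal_le_iff_le_toReal (measure_ne_top _ _)).1 this)
  have hlim := hsub.add ((h.1.tendsto_transitionOp hφ hρ f y).comp hσ.tendsto_atTop)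
  rw [zero_add] at hlim
  have hev := (tendsto_iff_norm_sub_tendsto_zero.1 hlim).eventually_lt_const hε
  obtain ⟨j, hj⟩ := hev.exists
  refine absurd hj (not_lt.2 ?_)
  simpa using hx (σ j)

theorem isStationaryMeasure_dirac {p : Circ} (h : IsDetFixedPoint P φ p)
    [IsProbabilityMeasure P] : IsStationaryMeasure P φ (Measure.dirac p) := by
  refine ⟨inferInstance, fun t A hA => ?_⟩
  rw [lintegral_dirac, Measure.dirac_apply' _ hA]
  by_cases hp : p ∈ A
  · rw [Set.indicator_of_mem hp, Pi.one_apply, eq_comm, ← measure_univ (μ := P)]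
    refine measure_congr ?_
    filter_upwards [h] with ω hω
    exact propext ⟨fun _ => trivial, fun _ => by change φ t ω p ∈ A; rwa [hω t]⟩
  · rw [Set.indicator_of_notMem hp, eq_comm, measure_eq_zero_iff_ae_notMem]
    filter_upwards [h] with ω hω
    rwa [hω t]

/-- The flow permutes the finite set `K` of heaviest atoms, and synchronisation reduces `K` to one
point `p`, which is then a deterministic fixed point. Uniqueness of the stationary measure gives `ρ
= dirac p`. -/
theorem Synchronising.measure_singleton_eq_zero [IsProbabilityMeasure P] (hφ : IsRDS ℱ θ φ)
    (h : Synchronising P φ) {ρ : Measure Circ} (hρ : IsStationaryMeasure P φ ρ) {q : Circ}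
    (hq : ¬ IsDetFixedPoint P φ q) : ρ {q} = 0 := by
  have := hρ.1
  by_contra hne
  obtain ⟨p, hp, hmax⟩ := exists_max_atom ρ hne
  set K : Set Circ := {y | ρ {p} ≤ ρ {y}} with hK
  have hKf : K.Finite := finite_setOf_le_measure_singleton ρ hp
  have hpK : p ∈ K := le_refl (ρ {p})
  -- Stationarity expresses the maximal mass `ρ {y}` as the mean of the masses of the preimages of
  -- `y`, none of which can exceed it.
  have hback : ∀ t, ∀ y ∈ K, ∀ᵐ ω ∂P, (φ t ω).symm y ∈ K := by
    intro t y hy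
    have h1 : ρ {y} = ∫⁻ ω, ρ {(φ t ω).symm y} ∂P := by
      conv_lhs => rw [← (isStationaryMeasure_iff hφ).1 hρ t]
      rw [Measure.map_apply (hφ.measurable_uncurry t) (measurableSet_singleton y),
        Measure.prod_apply (hφ.measurable_uncurry t (measurableSet_singleton y))]
      refine lintegral_congr fun ω => congrArg ρ ?_
      ext x
      exact (φ t ω).toEquiv.eq_symm_apply.symm
    have h2 : (fun ω => ρ {(φ t ω).symm y}) =ᵐ[P] fun _ => ρ {p} := by
      refine ae_eq_of_ae_le_of_lintegral_le (Eventually.of_forall fun ω => hmax _) ?_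
        aemeasurable_const ?_
      · rw [← h1]; exact measure_ne_top _ _
      · rw [← h1, lintegral_const, measure_univ, mul_one]; exact hy
    filter_upwards [h2] with ω hω
    exact hω.ge
  have hforw : ∀ t, ∀ᵐ ω ∂P, ∀ x ∈ K, φ t ω x ∈ K := by
    intro t
    filter_upwards [(ae_ball_iff hKf.countable).2 (hback t)] with ω hω x hx
    -- An injective self-map of a finite set is onto, so backward invariance gives forward
    -- invariance.
    have heq : (φ t ω).symm '' K = K :=
      Set.eq_of_subset_of_ncard_le (by rintro _ ⟨y, hy, rfl⟩; exact hω y hy)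
        (Set.ncard_image_of_injective K (φ t ω).symm.injective).ge hKf
    rw [← heq] at hx
    obtain ⟨y, hy, rfl⟩ := hx
    simpa using hy
  have hsing : ∀ x ∈ K, x = p := by
    intro x hx
    by_contra hxp
    obtain ⟨ω, hω, hs⟩ := ((ae_all_iff.2 fun n : ℕ => hforw (k.natTime n)).and (h x p)).exists
    -- Distinct points that stay in `K` remain at least `K.infsep` apart.
    have hpos : 0 < K.infsep := hKf.infsep_pos_iff_nontrivial.2 ⟨x, hx, p, hpK, hxp⟩
    obtain ⟨n, hn⟩ := ((hs.comp TimeDomain.tendsto_natTime).eventually_lt_const hpos).exists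
    refine absurd hn (not_lt.2 ?_)
    exact Set.infsep_le_dist_of_mem (hω n x hx) (hω n p hpK) ((φ (k.natTime n) ω).injective.ne hxp)
  have hdet : IsDetFixedPoint P φ p := isDetFixedPoint_of_forall hφ fun t => by
    filter_upwards [hforw t] with ω hω
    exact hsing _ (hω p hpK)
  have hdirac := h.stationary_unique hφ (isStationaryMeasure_dirac hdet) hρ
  rw [hdirac] at hne
  have hqp : q = p := by
    by_contra hqp
    refine hne ?_
    rw [Measure.dirac_apply' _ (measurableSet_singleton q),
      Set.indicator_of_notMem (by simpa using Ne.symm hqp)]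
  exact hq (hqp ▸ hdet)

end RDS

/-! ### Time averages -/

namespace TimeDomain

variable {k : TimeDomain}

/-- The times before the real number `T`. -/
def before (k : TimeDomain) (T : ℝ) : Set k.Time := {t | ((t : ℝ≥0) : ℝ) < T}

/-- The average over the times before `T`. -/
noncomputable def timeMean (g : k.Time → ℝ) (T : ℝ) : ℝ :=
  1 / T * ∫ t in k.before T, g t ∂k.timeMeasure

theorem measurableSet_before (T : ℝ) : MeasurableSet (k.before T) :=
  measurableSet_lt (measurable_coe_nnreal_real.comp measurable_subtype_coe) measurable_const

theorem before_natCast (n : ℕ) : k.before n = Set.Iio (k.natTime n) := by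
  ext t
  change ((t : ℝ≥0) : ℝ) < (n : ℝ) ↔ (t : ℝ≥0) < (n : ℝ≥0)
  rw [← NNReal.coe_natCast, NNReal.coe_lt_coe]

theorem before_mono {S T : ℝ} (h : S ≤ T) : k.before S ⊆ k.before T := fun _ ht => lt_of_lt_of_le ht h

theorem timeMeasure_before_natCast (n : ℕ) : k.timeMeasure (k.before n) = n := by
  rw [before_natCast, timeMeasure_lt_natTime]

theorem timeMeasure_before_lt_top (T : ℝ) : k.timeMeasure (k.before T) < ∞ := by
  refine (measure_mono (before_mono (Nat.le_ceil T))).trans_lt ?_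
  rw [timeMeasure_before_natCast]
  exact ENNReal.natCast_lt_top _

instance (T : ℝ) : IsFiniteMeasure (k.timeMeasure.restrict (k.before T)) :=
  ⟨by simpa using timeMeasure_before_lt_top T⟩

theorem real_before_natCast (n : ℕ) : k.timeMeasure.real (k.before n) = n := by
  simp [Measure.real, timeMeasure_before_natCast]

theorem real_before_le {T : ℝ} (hT : 0 ≤ T) : k.timeMeasure.real (k.before T) ≤ T + 1 := by
  calc k.timeMeasure.real (k.before T) ≤ k.timeMeasure.real (k.before ⌈T⌉₊) :=
        measureReal_mono (before_mono (Nat.le_ceil T)) (timeMeasure_before_lt_top _).ne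
    _ = ⌈T⌉₊ := real_before_natCast _
    _ ≤ T + 1 := (Nat.ceil_lt_add_one hT).le

theorem integrableOn_before {g : k.Time → ℝ} (hg : Measurable g) {C : ℝ} (hC : ∀ t, |g t| ≤ C)
    (T : ℝ) : IntegrableOn g (k.before T) k.timeMeasure :=
  Integrable.of_bound hg.aestronglyMeasurable C (Eventually.of_forall hC)

theorem abs_setIntegral_le {g : k.Time → ℝ} {C : ℝ} (hC : ∀ t, |g t| ≤ C) {S : Set k.Time} {n : ℕ}
    (hS : k.timeMeasure S = n) : |∫ t in S, g t ∂k.timeMeasure| ≤ C * n := by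
  have := norm_setIntegral_le_of_norm_le_const (μ := k.timeMeasure) (s := S) (f := g) (C := C)
    (by rw [hS]; exact ENNReal.natCast_lt_top _) fun t _ => hC t
  simpa [Measure.real, hS] using this

theorem abs_integral_before_sub_le {g : k.Time → ℝ} (hg : Measurable g) {C : ℝ}
    (hC : ∀ t, |g t| ≤ C) {m n : ℕ} {T : ℝ} (hm : (m : ℝ) ≤ T) (hn : T ≤ n) :
    |∫ t in k.before T, g t ∂k.timeMeasure - ∫ t in k.before m, g t ∂k.timeMeasure| ≤
      C * (n - m) := by
  have hC0 : 0 ≤ C := (abs_nonneg _).trans (hC 0)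
  rw [← setIntegral_sdiff (measurableSet_before _) (integrableOn_before hg hC T) (before_mono hm)]
  have hfin : k.timeMeasure (k.before T \ k.before m) < ∞ :=
    (measure_mono Set.sdiff_subset).trans_lt (timeMeasure_before_lt_top T)
  refine (norm_setIntegral_le_of_norm_le_const (f := g) hfin fun t _ => hC t).trans ?_
  refine mul_le_mul_of_nonneg_left ?_ hC0
  calc k.timeMeasure.real (k.before T \ k.before m)
      = k.timeMeasure.real (k.before T) - k.timeMeasure.real (k.before m) :=
        measureReal_sdiff (before_mono hm) (measurableSet_before _)
          (timeMeasure_before_lt_top _).ne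
    _ ≤ n - m := by
        rw [real_before_natCast, ← real_before_natCast (k := k) n]
        exact sub_le_sub_right
          (measureReal_mono (before_mono hn) (timeMeasure_before_lt_top _).ne) _

/-- Averages converge as soon as they converge along the squares. -/
theorem tendsto_timeMean_of_sq {g : k.Time → ℝ} (hg : Measurable g) {C : ℝ} (hC : ∀ t, |g t| ≤ C)
    {c : ℝ} (h : Tendsto (fun j : ℕ => timeMean g ((j ^ 2 : ℕ) : ℝ)) atTop (𝓝 c)) :
    Tendsto (timeMean g) atTop (𝓝 c) := by
  have hC0 : 0 ≤ C := (abs_nonneg _).trans (hC 0)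
  have hfl : Tendsto (fun T : ℝ => ⌊√T⌋₊) atTop atTop :=
    tendsto_nat_floor_atTop.comp Real.tendsto_sqrt_atTop
  have herr : ∀ᶠ T : ℝ in atTop,
      |timeMean g T - timeMean g ((⌊√T⌋₊ ^ 2 : ℕ) : ℝ)| ≤ 6 * C / (⌊√T⌋₊ : ℝ) := by
    filter_upwards [eventually_ge_atTop 1] with T hT
    set j := ⌊√T⌋₊ with hj
    have hT0 : 0 < T := by linarith
    have hj1 : (1 : ℝ) ≤ j := by
      have : 1 ≤ j := Nat.le_floor (by simpa using Real.one_le_sqrt.2 hT)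
      exact_mod_cast this
    have hle : ((j ^ 2 : ℕ) : ℝ) ≤ T := by
      push_cast
      calc (j : ℝ) ^ 2 ≤ √T ^ 2 := by gcongr; exact Nat.floor_le (Real.sqrt_nonneg _)
        _ = T := Real.sq_sqrt hT0.le
    have hge : T ≤ (((j + 1) ^ 2 : ℕ) : ℝ) := by
      push_cast
      calc T = √T ^ 2 := (Real.sq_sqrt hT0.le).symm
        _ ≤ ((j : ℝ) + 1) ^ 2 := by gcongr; exact (Nat.lt_floor_add_one _).le
    have h1 := abs_integral_before_sub_le hg hC hle hge
    have h2 := abs_setIntegral_le hC (timeMeasure_before_natCast (k := k) (j ^ 2))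
    unfold timeMean
    set A := ∫ t in k.before T, g t ∂k.timeMeasure
    set B := ∫ t in k.before ((j ^ 2 : ℕ) : ℝ), g t ∂k.timeMeasure
    push_cast at h1 h2 hle hge ⊢
    have hj2 : (0 : ℝ) < (j : ℝ) ^ 2 := by positivity
    -- One term is the integral over the times from `j ^ 2` to `T`, the other the change of
    -- normalisation. Each is at most `3 * C / j`, since `T - j ^ 2 ≤ 2 * j + 1 ≤ 3 * j`.
    have hsplit : 1 / T * A - 1 / (j : ℝ) ^ 2 * B =
        1 / T * (A - B) - B * ((T - (j : ℝ) ^ 2) / (T * (j : ℝ) ^ 2)) := by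
      field_simp
      ring
    have hb1 : |1 / T * (A - B)| ≤ C * (3 / j) := by
      rw [abs_mul, abs_of_pos (by positivity : (0 : ℝ) < 1 / T)]
      calc 1 / T * |A - B| ≤ 1 / (j : ℝ) ^ 2 * (C * (((j : ℝ) + 1) ^ 2 - (j : ℝ) ^ 2)) := by
            gcongr
        _ ≤ 1 / (j : ℝ) ^ 2 * (C * (3 * j)) := by
            gcongr
            nlinarith
        _ = C * (3 / j) := by field_simp
    have hb2 : |B * ((T - (j : ℝ) ^ 2) / (T * (j : ℝ) ^ 2))| ≤ C * (3 / j) := by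
      rw [abs_mul, abs_of_nonneg (a := (T - (j : ℝ) ^ 2) / (T * (j : ℝ) ^ 2))
        (div_nonneg (by linarith) (by positivity))]
      calc |B| * ((T - (j : ℝ) ^ 2) / (T * (j : ℝ) ^ 2))
          ≤ (C * (j : ℝ) ^ 2) * ((3 * j) / ((j : ℝ) ^ 2 * (j : ℝ) ^ 2)) := by
            have hnum : T - (j : ℝ) ^ 2 ≤ 3 * j := by nlinarith
            have hnum0 : 0 ≤ T - (j : ℝ) ^ 2 := by linarith
            refine mul_le_mul h2 ?_ (by positivity) (by positivity)
            exact div_le_div₀ (by positivity) hnum (by positivity) (by gcongr)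
        _ = C * (3 / j) := by field_simp
    rw [hsplit]
    calc _ ≤ C * (3 / j) + C * (3 / j) := (abs_sub _ _).trans (add_le_add hb1 hb2)
      _ = 6 * C / j := by ring
  have h0 : Tendsto (fun T : ℝ => 6 * C / (⌊√T⌋₊ : ℝ)) atTop (𝓝 0) :=
    (tendsto_const_div_atTop_nhds_zero_nat (6 * C)).comp hfl
  have h1 := squeeze_zero_norm' (f := fun T => timeMean g T - timeMean g ((⌊√T⌋₊ ^ 2 : ℕ) : ℝ))
    herr h0
  have h2 := h1.add (h.comp hfl)
  rw [zero_add] at h2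
  exact h2.congr fun T => by simp

theorem tendsto_timeMean_zero {g : k.Time → ℝ} (hg : Measurable g) {C : ℝ} (hC : ∀ t, |g t| ≤ C)
    (h : Tendsto g atTop (𝓝 0)) : Tendsto (timeMean g) atTop (𝓝 0) := by
  have hC0 : 0 ≤ C := (abs_nonneg _).trans (hC 0)
  rw [Metric.tendsto_nhds]
  intro ε hε
  have hε3 : 0 < ε / 3 := by positivity
  obtain ⟨t₀, ht₀⟩ := eventually_atTop.1 (Metric.tendsto_nhds.1 h (ε / 3) hε3)
  obtain ⟨N, hN⟩ := exists_natTime_ge t₀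
  have hpt : ∀ t, |g t| ≤ (k.before N).indicator (fun _ => C) t + ε / 3 := by
    intro t
    by_cases ht : t ∈ k.before N
    · rw [Set.indicator_of_mem ht]
      linarith [hC t]
    · rw [Set.indicator_of_notMem ht, zero_add]
      rw [before_natCast, Set.mem_Iio, not_lt] at ht
      have := ht₀ t (hN.trans ht)
      rw [dist_zero_right] at this
      exact this.le
  have hbound : ∀ T : ℝ, 0 ≤ T →
      |∫ t in k.before T, g t ∂k.timeMeasure| ≤ C * N + ε / 3 * (T + 1) := by
    intro T hT
    have hi : Integrable ((k.before N).indicator fun _ => C)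
        (k.timeMeasure.restrict (k.before T)) :=
      (integrable_const C).indicator (measurableSet_before _)
    calc |∫ t in k.before T, g t ∂k.timeMeasure|
        ≤ ∫ t in k.before T, |g t| ∂k.timeMeasure := abs_integral_le_integral_abs
      _ ≤ ∫ t in k.before T, ((k.before N).indicator (fun _ => C) t + ε / 3) ∂k.timeMeasure :=
          integral_mono (integrableOn_before hg hC T).abs (hi.add (integrable_const _)) hpt
      _ = k.timeMeasure.real (k.before N ∩ k.before T) * C +
          k.timeMeasure.real (k.before T) * (ε / 3) := by
          rw [integral_add hi (integrable_const _), integral_indicator (measurableSet_before _)]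
          simp [Measure.restrict_restrict (measurableSet_before (k := k) (N : ℝ))]
      _ ≤ N * C + (T + 1) * (ε / 3) := by
          have hN' : k.timeMeasure.real (k.before N ∩ k.before T) ≤ N :=
            (measureReal_mono Set.inter_subset_left (timeMeasure_before_lt_top _).ne).trans
              (real_before_natCast (k := k) N).le
          gcongr
          exact real_before_le hT
      _ = C * N + ε / 3 * (T + 1) := by ring
  -- Beyond this threshold `C * N`, `ε / 3 * T` and `ε / 3` are each at most `ε / 3 * T`, the first
  -- strictly less.
  filter_upwards [eventually_gt_atTop (max 1 (C * N / (ε / 3)))] with T hT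
  have hT1 : 1 < T := (le_max_left _ _).trans_lt hT
  have hT2 : C * N < T * (ε / 3) := (div_lt_iff₀ hε3).1 ((le_max_right _ _).trans_lt hT)
  rw [dist_zero_right, timeMean, norm_mul, Real.norm_eq_abs, Real.norm_eq_abs,
    abs_of_pos (by positivity : (0 : ℝ) < 1 / T), one_div_mul_eq_div, div_lt_iff₀ (by linarith)]
  refine (hbound T (by linarith)).trans_lt ?_
  nlinarith

/-- Shifting a bounded function in time changes its integral by a bounded amount. -/
theorem abs_integral_shift_sub_le {g : k.Time → ℝ} (hg : Measurable g) {C : ℝ}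
    (hC : ∀ t, |g t| ≤ C) (m n : ℕ) :
    |∫ t in k.before n, g (k.natTime m + t) ∂k.timeMeasure -
      ∫ t in k.before n, g t ∂k.timeMeasure| ≤ 2 * C * m := by
  have hadd : k.natTime m + k.natTime n = k.natTime (m + n) := Subtype.ext (by simp)
  have hadd' : k.natTime n + k.natTime m = k.natTime (m + n) := by rw [add_comm, hadd]
  have hIntg : ∀ S ⊆ k.before ((m + n : ℕ) : ℝ), IntegrableOn g S k.timeMeasure := fun S hS =>
    (integrableOn_before hg hC _).mono_set hS
  have h1 : ∫ t in k.before n, g (k.natTime m + t) ∂k.timeMeasure =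
      ∫ t in Set.Ico (k.natTime m) (k.natTime (m + n)), g t ∂k.timeMeasure := by
    have := setIntegral_map (μ := k.timeMeasure) (g := fun t => k.natTime m + t) (f := g)
      (s := Set.Iio (k.natTime (m + n))) measurableSet_Iio hg.aestronglyMeasurable (by fun_prop)
    rw [map_add_timeMeasure, Measure.restrict_restrict measurableSet_Iio] at this
    have hpre : (fun t => k.natTime m + t) ⁻¹' Set.Iio (k.natTime (m + n)) = k.before n := by
      rw [before_natCast]
      ext t
      change (m : ℝ≥0) + t < ((m + n : ℕ) : ℝ≥0) ↔ (t : ℝ≥0) < n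
      rw [Nat.cast_add]
      exact add_lt_add_iff_left _
    rw [hpre] at this
    rw [← this, Set.inter_comm, Set.Ici_inter_Iio]
  -- Used with `a = m` and `a = n`: the two integrals differ only by the pieces over `[0, m)` and
  -- `[n, n + m)`.
  have hsplit : ∀ a ≤ m + n, ∫ t in k.before ((m + n : ℕ) : ℝ), g t ∂k.timeMeasure =
      ∫ t in k.before a, g t ∂k.timeMeasure +
        ∫ t in Set.Ico (k.natTime a) (k.natTime (m + n)), g t ∂k.timeMeasure := by
    intro a ha
    rw [before_natCast, before_natCast, ← Set.Iio_union_Ico_eq_Iio (natTime_mono ha)]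
    refine setIntegral_union ?_ measurableSet_Ico (hIntg _ ?_) (hIntg _ ?_)
    · exact Set.disjoint_left.2 fun t h1 h2 => not_lt.2 h2.1 h1
    · rw [before_natCast]; exact Set.Iio_subset_Iio (natTime_mono ha)
    · rw [before_natCast]; exact Set.Ico_subset_Iio_self
  have h2 := hsplit m (Nat.le_add_right _ _)
  have h3 := hsplit n (Nat.le_add_left _ _)
  have h4 := abs_setIntegral_le hC (timeMeasure_before_natCast (k := k) m)
  have h5 := abs_setIntegral_le hC (hadd' ▸ timeMeasure_Ico (k.natTime n) m)
  rw [h1]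
  rw [abs_le] at *
  constructor <;> linarith

end TimeDomain

/-! ### Joint measurability of trajectories in time and noise -/

section JointMeasurability

variable {k : TimeDomain} {Ω : Type*} [mΩ : MeasurableSpace Ω] {P : Measure Ω}
  {ℱ : Filtration k.Time mΩ} {θ : k.Time → Ω → Ω} {φ : k.Time → Ω → (Circ ≃ₜ Circ)}

theorem measurable_comp_countable_range {α β γ : Type*} [MeasurableSpace α]
    [MeasurableSingletonClass α] [MeasurableSpace β] [MeasurableSpace γ] {a : α → α}
    (ha : Measurable a) (hc : (Set.range a).Countable) {g : α → β → γ}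
    (hg : ∀ d, Measurable (g d)) : Measurable fun p : α × β => g (a p.1) p.2 := by
  intro S hS
  have : (fun p : α × β => g (a p.1) p.2) ⁻¹' S =
      ⋃ d ∈ Set.range a, (a ⁻¹' {d}) ×ˢ (g d ⁻¹' S) := by
    ext p
    simp only [Set.mem_preimage, Set.mem_iUnion, Set.mem_prod, Set.mem_singleton_iff, exists_prop]
    constructor
    · exact fun h => ⟨a p.1, ⟨p.1, rfl⟩, rfl, h⟩
    · rintro ⟨d, -, rfl, h⟩
      exact h
  rw [this]
  exact MeasurableSet.biUnion hc fun d _ => (ha (measurableSet_singleton d)).prod (hg d hS)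

/-- A trajectory is the pointwise limit of its values at right approximations of the time, which
take countably many values. -/
theorem IsRDS.measurable_time (hφ : IsRDS ℱ θ φ) (x : Circ) :
    Measurable fun p : k.Time × Ω => φ p.1 p.2 x := by
  obtain ⟨a, ham, hac, ha⟩ := k.exists_right_approx
  refine measurable_of_tendsto_metrizable (f := fun n (p : k.Time × Ω) => φ (a n p.1) p.2 x)
    (fun n => measurable_comp_countable_range (g := fun d ω => φ d ω x) (ham n) (hac n)
      fun d => hφ.measurable_apply' d x) ?_
  rw [tendsto_pi_nhds]
  intro p
  exact hφ.right_continuous _ p.1 (fun _ => x) x (ha p.1).1 (ha p.1).2 tendsto_const_nhds p.2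

end JointMeasurability

/-! ### A law of large numbers -/

section LLN

variable {k : TimeDomain} {Ω : Type*} [mΩ : MeasurableSpace Ω] {P : Measure Ω}

/-- The strip splits into two one-sided strips, all of whose slices have measure at most `m`. -/
theorem TimeDomain.prod_real_near_le (m n : ℕ) :
    ((k.timeMeasure.restrict (k.before n)).prod (k.timeMeasure.restrict (k.before n))).real
      {p | p.2 < p.1 + k.natTime m ∧ p.1 < p.2 + k.natTime m} ≤ 2 * m * n := by
  set ν := k.timeMeasure.restrict (k.before n) with hν
  have hνn : ν Set.univ = n := by
    rw [hν, Measure.restrict_apply_univ, TimeDomain.timeMeasure_before_natCast]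
  have hIco : ∀ s : k.Time, ν (Set.Ico s (s + k.natTime m)) ≤ m := fun s =>
    (Measure.restrict_apply_le _ _).trans (TimeDomain.timeMeasure_Ico s m).le
  have hadd : Measurable fun s : k.Time => s + k.natTime m := by fun_prop
  have hD1 : MeasurableSet {p : k.Time × k.Time | p.2 ∈ Set.Ico p.1 (p.1 + k.natTime m)} :=
    (measurableSet_le measurable_fst measurable_snd).inter
      (measurableSet_lt (f := fun p : k.Time × k.Time => p.2) measurable_snd
        (hadd.comp measurable_fst))
  have hD2 : MeasurableSet {p : k.Time × k.Time | p.1 ∈ Set.Ico p.2 (p.2 + k.natTime m)} :=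
    (measurableSet_le measurable_snd measurable_fst).inter
      (measurableSet_lt (f := fun p : k.Time × k.Time => p.1) measurable_fst
        (hadd.comp measurable_snd))
  have h1 : (ν.prod ν) {p | p.2 ∈ Set.Ico p.1 (p.1 + k.natTime m)} ≤ m * n := by
    rw [Measure.prod_apply hD1]
    calc _ ≤ ∫⁻ _s, (m : ℝ≥0∞) ∂ν := lintegral_mono fun s => hIco s
      _ = m * n := by rw [lintegral_const, hνn]
  have h2 : (ν.prod ν) {p | p.1 ∈ Set.Ico p.2 (p.2 + k.natTime m)} ≤ m * n := by
    rw [Measure.prod_apply_symm hD2]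
    calc _ ≤ ∫⁻ _s, (m : ℝ≥0∞) ∂ν := lintegral_mono fun s => hIco s
      _ = m * n := by rw [lintegral_const, hνn]
  have h3 : (ν.prod ν) {p | p.2 < p.1 + k.natTime m ∧ p.1 < p.2 + k.natTime m} ≤
      ((2 * m * n : ℕ) : ℝ≥0∞) := by
    calc _ ≤ (ν.prod ν) ({p | p.2 ∈ Set.Ico p.1 (p.1 + k.natTime m)} ∪
          {p | p.1 ∈ Set.Ico p.2 (p.2 + k.natTime m)}) := by
          refine measure_mono fun p hp => ?_
          rcases le_total p.1 p.2 with h | h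
          · exact Or.inl ⟨h, hp.1⟩
          · exact Or.inr ⟨h, hp.2⟩
      _ ≤ m * n + m * n := (measure_union_le _ _).trans (add_le_add h1 h2)
      _ = ((2 * m * n : ℕ) : ℝ≥0∞) := by push_cast; ring
  have := ENNReal.toReal_mono (ENNReal.natCast_ne_top _) h3
  rw [ENNReal.toReal_natCast] at this
  exact_mod_cast this

/-- After expanding the square, only pairs of times less than `m` apart contribute, so the growth in
`n` is linear rather than quadratic. -/
theorem integral_sq_integral_le [IsProbabilityMeasure P] {W : k.Time → Ω → ℝ}
    (hW : Measurable fun p : k.Time × Ω => W p.1 p.2) {C : ℝ} (hC : ∀ t ω, |W t ω| ≤ C) {m : ℕ}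
    (horth : ∀ s t, s + k.natTime m ≤ t → ∫ ω, W s ω * W t ω ∂P = 0) (n : ℕ) :
    ∫ ω, (∫ t in k.before n, W t ω ∂k.timeMeasure) ^ 2 ∂P ≤ C ^ 2 * (2 * m * n) := by
  set ν := k.timeMeasure.restrict (k.before n) with hν
  have hmul : ∀ s t ω, |W s ω * W t ω| ≤ C ^ 2 := fun s t ω => by
    rw [abs_mul, sq]
    exact mul_le_mul (hC s ω) (hC t ω) (abs_nonneg _) ((abs_nonneg _).trans (hC s ω))
  have hm : Measurable fun q : Ω × (k.Time × k.Time) => W q.2.1 q.1 * W q.2.2 q.1 :=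
    (hW.comp (measurable_snd.fst.prodMk measurable_fst)).mul
      (hW.comp (measurable_snd.snd.prodMk measurable_fst))
  have hIntg : Integrable (Function.uncurry fun ω (p : k.Time × k.Time) => W p.1 ω * W p.2 ω)
      (P.prod (ν.prod ν)) :=
    Integrable.of_bound hm.aestronglyMeasurable (C ^ 2) (Eventually.of_forall fun q => hmul _ _ _)
  have h1 : ∫ ω, (∫ t, W t ω ∂ν) ^ 2 ∂P =
      ∫ p : k.Time × k.Time, ∫ ω, W p.1 ω * W p.2 ω ∂P ∂(ν.prod ν) := by
    rw [← integral_integral_swap hIntg]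
    refine integral_congr_ae (Eventually.of_forall fun ω => ?_)
    simp only
    rw [sq, ← integral_prod_mul]
  rw [h1]
  set D : Set (k.Time × k.Time) := {p | p.2 < p.1 + k.natTime m ∧ p.1 < p.2 + k.natTime m} with hD
  rw [← setIntegral_eq_integral_of_forall_compl_eq_zero (s := D)]
  · refine (Real.le_norm_self _).trans ((norm_setIntegral_le_of_norm_le_const (C := C ^ 2)
      (measure_lt_top _ _) fun p _ => ?_).trans ?_)
    · have := norm_integral_le_of_norm_le_const (μ := P) (C := C ^ 2)
        (f := fun ω => W p.1 ω * W p.2 ω) (Eventually.of_forall fun ω => hmul _ _ ω)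
      simpa using this
    · exact mul_le_mul_of_nonneg_left (TimeDomain.prod_real_near_le m n) (sq_nonneg C)
  · intro p hp
    rw [hD, Set.mem_ofPred_eq, not_and_or, not_lt, not_lt] at hp
    rcases hp with h | h
    · exact horth _ _ h
    · simp only [mul_comm (W p.1 _)]
      exact horth _ _ h

/-- A bounded process that is uncorrelated at large lags averages to zero along the squares. -/
theorem ae_tendsto_timeMean_sq_zero [IsProbabilityMeasure P] {W : k.Time → Ω → ℝ}
    (hW : Measurable fun p : k.Time × Ω => W p.1 p.2) {C : ℝ} (hC : ∀ t ω, |W t ω| ≤ C) {m : ℕ}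
    (horth : ∀ s t, s + k.natTime m ≤ t → ∫ ω, W s ω * W t ω ∂P = 0) :
    ∀ᵐ ω ∂P, Tendsto (fun j : ℕ => TimeDomain.timeMean (fun t => W t ω) ((j ^ 2 : ℕ) : ℝ)) atTop
      (𝓝 0) := by
  set V : ℕ → Ω → ℝ := fun j ω => TimeDomain.timeMean (fun t => W t ω) ((j ^ 2 : ℕ) : ℝ) with hV
  have hI : ∀ n : ℕ, Measurable fun ω => ∫ t in k.before n, W t ω ∂k.timeMeasure := fun n =>
    (StronglyMeasurable.integral_prod_left' hW.stronglyMeasurable).measurable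
  have hVm : ∀ j, Measurable (V j) := fun j => (hI (j ^ 2)).const_mul _
  have hVle : ∀ j : ℕ, ∫ ω, V j ω ^ 2 ∂P ≤ 2 * m * C ^ 2 * (1 / (j : ℝ) ^ 2) := by
    intro j
    have h1 := integral_sq_integral_le hW hC horth (j ^ 2)
    rcases Nat.eq_zero_or_pos j with rfl | hj
    · simp [hV, TimeDomain.timeMean]
    have hj' : (0 : ℝ) < j := by exact_mod_cast hj
    simp only [hV, TimeDomain.timeMean, mul_pow]
    rw [integral_const_mul]
    push_cast at h1 ⊢
    calc (1 / (j : ℝ) ^ 2) ^ 2 * _ ≤ (1 / (j : ℝ) ^ 2) ^ 2 * (C ^ 2 * (2 * m * (j : ℝ) ^ 2)) := by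
          gcongr
      _ = 2 * m * C ^ 2 * (1 / (j : ℝ) ^ 2) := by field_simp
  have hVb : ∀ j ω, |V j ω| ≤ C := by
    intro j ω
    have hC0 : 0 ≤ C := (abs_nonneg _).trans (hC 0 ω)
    have h1 := TimeDomain.abs_setIntegral_le (fun t => hC t ω)
      (TimeDomain.timeMeasure_before_natCast (k := k) (j ^ 2))
    rcases Nat.eq_zero_or_pos j with rfl | hj
    · simpa [hV, TimeDomain.timeMean] using hC0
    have hj' : (0 : ℝ) < ((j ^ 2 : ℕ) : ℝ) := by positivity
    simp only [hV, TimeDomain.timeMean]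
    rw [abs_mul, abs_of_pos (by positivity), one_div_mul_eq_div, div_le_iff₀ hj']
    exact h1
  have hVi : ∀ j, Integrable (fun ω => V j ω ^ 2) P := fun j =>
    Integrable.of_bound ((hVm j).pow_const 2).aestronglyMeasurable (C ^ 2)
      (Eventually.of_forall fun ω => by
        rw [norm_pow]
        exact pow_le_pow_left₀ (norm_nonneg _) (hVb j ω) 2)
  have hsum : Summable fun j : ℕ => 2 * m * C ^ 2 * (1 / (j : ℝ) ^ 2) :=
    (Real.summable_one_div_nat_pow.2 one_lt_two).mul_left _
  -- The second moments are of order `1 / j ^ 2`, so the sum of the squares is almost surely finite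
  -- and its terms tend to zero.
  have hfin : ∫⁻ ω, ∑' j, ENNReal.ofReal (V j ω ^ 2) ∂P ≠ ∞ := by
    rw [lintegral_tsum fun j => ((hVm j).pow_const 2).ennreal_ofReal.aemeasurable]
    refine ne_top_of_le_ne_top hsum.tsum_ofReal_ne_top (ENNReal.tsum_le_tsum fun j => ?_)
    rw [← ofReal_integral_eq_lintegral_ofReal (hVi j)
      (Eventually.of_forall fun ω => sq_nonneg _)]
    exact ENNReal.ofReal_le_ofReal (hVle j)
  have hae := ae_lt_top (Measurable.tsum fun j => ((hVm j).pow_const 2).ennreal_ofReal) hfin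
  filter_upwards [hae] with ω hω
  have h1 := ENNReal.tendsto_atTop_zero_of_tsum_ne_top hω.ne
  have h2 := (ENNReal.tendsto_toReal ENNReal.zero_ne_top).comp h1
  have h3 : Tendsto (fun j => V j ω ^ 2) atTop (𝓝 0) := by
    refine h2.congr fun j => ?_
    simp [ENNReal.toReal_ofReal (sq_nonneg _)]
  have h4 := h3.sqrt
  simp only [Real.sqrt_sq_eq_abs, Real.sqrt_zero] at h4
  exact (tendsto_zero_iff_abs_tendsto_zero _).2 h4

variable {ℱ : Filtration k.Time mΩ} {θ : k.Time → Ω → Ω} {φ : k.Time → Ω → (Circ ≃ₜ Circ)}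

/-- The summand is `f` at time `t + m` minus its conditional expectation given `ℱ t`. It is
orthogonal to everything known at time `t`, in particular to the summands at times up to `t - m`. -/
theorem ae_tendsto_timeMean_sub_transitionOp [IsProbabilityMeasure P] (hθ : IsNoise P ℱ θ)
    (hφ : IsRDS ℱ θ φ) (f : C(Circ, ℝ)) (x : Circ) (m : ℕ) :
    ∀ᵐ ω ∂P, Tendsto (fun j : ℕ => TimeDomain.timeMean (fun t => f (φ (t + k.natTime m) ω x) -
      transitionOp (P := P) hφ (k.natTime m) f (φ t ω x)) ((j ^ 2 : ℕ) : ℝ)) atTop (𝓝 0) := by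
  set g := transitionOp (P := P) hφ (k.natTime m) f with hg
  have hb : ∀ t ω, |f (φ (t + k.natTime m) ω x) - g (φ t ω x)| ≤ 2 * ‖f‖ := fun t ω => by
    refine (abs_sub _ _).trans ?_
    linarith [abs_apply_le_norm f (φ (t + k.natTime m) ω x),
      abs_transitionOp_le (P := P) hφ (k.natTime m) f (φ t ω x)]
  have hadd : Measurable fun p : k.Time × Ω => (p.1 + k.natTime m, p.2) := by fun_prop
  refine ae_tendsto_timeMean_sq_zero (m := m)
    (W := fun t ω => f (φ (t + k.natTime m) ω x) - g (φ t ω x)) ?_ hb ?_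
  · exact (f.continuous.measurable.comp ((hφ.measurable_time x).comp hadd)).sub
      (g.continuous.measurable.comp (hφ.measurable_time x))
  · intro s t hst
    have hs : s ≤ s + k.natTime m := by
      change (s : ℝ≥0) ≤ s + m
      exact le_self_add
    have hWm : Measurable[ℱ t] fun ω => f (φ (s + k.natTime m) ω x) - g (φ s ω x) :=
      (f.continuous.measurable.comp ((hφ.measurable_apply _ x).mono (ℱ.mono hst) le_rfl)).sub
        (g.continuous.measurable.comp
          ((hφ.measurable_apply s x).mono (ℱ.mono (hs.trans hst)) le_rfl))
    have key := integral_mul_apply_add hθ hφ t (k.natTime m) f x hWm (hb s)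
    have hWm' := hWm.mono (ℱ.le t) le_rfl
    have hi : ∀ (u : k.Time) (h : C(Circ, ℝ)),
        Integrable (fun ω => (f (φ (s + k.natTime m) ω x) - g (φ s ω x)) * h (φ u ω x)) P :=
      fun u h => (integrable_apply hφ u h x).bdd_mul hWm'.aestronglyMeasurable
        (Eventually.of_forall (hb s))
    simp only [mul_sub]
    rw [integral_sub (hi _ f) (hi _ g), key, sub_self]

/-- The law of large numbers for the trajectory of a given point. -/
theorem StablySynchronising.ae_tendsto_timeMean [IsProbabilityMeasure P] (hθ : IsNoise P ℱ θ)
    (hφ : IsRDS ℱ θ φ) (h : StablySynchronising P φ) {ρ : Measure Circ}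
    (hρ : IsStationaryMeasure P φ ρ) (f : C(Circ, ℝ)) (x : Circ) :
    ∀ᵐ ω ∂P, Tendsto (TimeDomain.timeMean fun t => f (φ t ω x)) atTop (𝓝 (∫ y, f y ∂ρ)) := by
  filter_upwards [ae_all_iff.2 fun m => ae_tendsto_timeMean_sub_transitionOp hθ hφ f x m] with ω hω
  have hfm : Measurable fun t => f (φ t ω x) :=
    f.continuous.measurable.comp ((hφ.measurable_time x).comp measurable_prodMk_right)
  have hfb : ∀ t, |f (φ t ω x)| ≤ ‖f‖ := fun t => abs_apply_le_norm f _
  refine TimeDomain.tendsto_timeMean_of_sq hfm hfb ?_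
  rw [Metric.tendsto_nhds]
  intro ε hε
  -- Three errors of `ε / 3`: shifting `f` by time `m`, replacing the shift by `g`, and replacing
  -- `g` by the constant `c`, which is uniformly close to it.
  obtain ⟨m, hm⟩ := h.exists_abs_transitionOp_sub_le hφ hρ f (show 0 < ε / 3 by positivity)
  set g := transitionOp (P := P) hφ (k.natTime m) f with hg
  set c := ∫ y, f y ∂ρ with hc
  have hgm : Measurable fun t => g (φ t ω x) :=
    g.continuous.measurable.comp ((hφ.measurable_time x).comp measurable_prodMk_right)
  have hsm : Measurable fun t => f (φ (t + k.natTime m) ω x) :=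
    hfm.comp (by fun_prop : Measurable fun t : k.Time => t + k.natTime m)
  have hsq : Tendsto (fun j : ℕ => ((j ^ 2 : ℕ) : ℝ)) atTop atTop :=
    tendsto_natCast_atTop_atTop.comp (tendsto_pow_atTop two_ne_zero)
  have hlast : Tendsto (fun j : ℕ => 2 * ‖f‖ * m / ((j ^ 2 : ℕ) : ℝ)) atTop (𝓝 0) :=
    hsq.const_div_atTop _
  filter_upwards [Metric.tendsto_nhds.1 (hω m) (ε / 3) (by positivity),
    hlast.eventually_lt_const (show 0 < ε / 3 by positivity), eventually_ge_atTop 1] with j h1 h2 hj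
  have hn : (0 : ℝ) < ((j ^ 2 : ℕ) : ℝ) := by
    have : 0 < j ^ 2 := by positivity
    exact_mod_cast this
  set n := j ^ 2 with hn_def
  have hshift := TimeDomain.abs_integral_shift_sub_le hfm hfb m n
  simp only [add_comm (k.natTime m)] at hshift
  have hgc : |∫ t in k.before n, (g (φ t ω x) - c) ∂k.timeMeasure| ≤ ε / 3 * n :=
    TimeDomain.abs_setIntegral_le (fun t => (hm (φ t ω x)).le)
      (TimeDomain.timeMeasure_before_natCast n)
  have hfi := TimeDomain.integrableOn_before hfm hfb n
  have hsi := TimeDomain.integrableOn_before hsm (fun t => hfb _) n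
  have hgi := TimeDomain.integrableOn_before hgm (fun t => abs_apply_le_norm g _) n
  have hconst : ∫ _t in k.before n, c ∂k.timeMeasure = n * c := by
    rw [setIntegral_const, TimeDomain.real_before_natCast, smul_eq_mul]
  rw [integral_sub hgi (integrable_const c), hconst] at hgc
  rw [dist_zero_right, TimeDomain.timeMean, integral_sub hsi hgi, norm_mul, Real.norm_eq_abs,
    Real.norm_eq_abs, abs_of_pos (by positivity), one_div_mul_eq_div, div_lt_iff₀ hn] at h1
  rw [div_lt_iff₀ hn] at h2
  rw [Real.dist_eq, TimeDomain.timeMean, one_div_mul_eq_div,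
    show ∀ a : ℝ, a / n - c = (a - n * c) / n from fun a => by field_simp, abs_div,
    abs_of_pos hn, div_lt_iff₀ hn]
  rw [abs_lt] at h1 ⊢
  rw [abs_le] at hshift hgc
  constructor <;> nlinarith

/-! ### Occupation times of arcs -/

/-- Outer regularity followed by Urysohn's lemma. -/
theorem exists_continuousMap_ge_indicator (ρ : Measure Circ) [IsProbabilityMeasure ρ]
    {F : Set Circ} (hF : IsClosed F) {ε : ℝ} (hε : 0 < ε) :
    ∃ f : C(Circ, ℝ), (∀ x, F.indicator (fun _ => (1 : ℝ)) x ≤ f x) ∧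
      ∫ x, f x ∂ρ < ρ.real F + ε := by
  obtain ⟨U, hFU, hU, hlt⟩ := F.exists_isOpen_lt_add (μ := ρ) (measure_ne_top _ _)
    (ENNReal.ofReal_pos.2 hε).ne'
  obtain ⟨f, hf0, hf1, hf⟩ := exists_continuous_zero_one_of_isClosed hU.isClosed_compl hF
    (Set.disjoint_left.2 fun x hx hxF => hx (hFU hxF))
  refine ⟨f, fun x => ?_, ?_⟩
  · by_cases hx : x ∈ F
    · rw [Set.indicator_of_mem hx, hf1 hx]; rfl
    · rw [Set.indicator_of_notMem hx]; exact (hf x).1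
  · have hle : ∫ x, f x ∂ρ ≤ ρ.real U := by
      rw [← integral_indicator_one hU.measurableSet]
      refine integral_mono ?_ ((integrable_const 1).indicator hU.measurableSet) fun x => ?_
      · exact Integrable.of_bound f.continuous.aestronglyMeasurable ‖f‖
          (Eventually.of_forall (abs_apply_le_norm f))
      · by_cases hx : x ∈ U
        · rw [Set.indicator_of_mem hx]; exact (hf x).2
        · rw [Set.indicator_of_notMem hx, hf0 hx]; rfl
    refine hle.trans_lt ?_
    have := (ENNReal.toReal_lt_toReal (measure_ne_top _ _)
      (ENNReal.add_ne_top.2 ⟨measure_ne_top _ _, ENNReal.ofReal_ne_top⟩)).2 hlt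
    rwa [ENNReal.toReal_add (measure_ne_top _ _) ENNReal.ofReal_ne_top,
      ENNReal.toReal_ofReal hε.le] at this

/-- The null set is chosen for the trajectory of `0` alone; every other trajectory off the crack
point synchronises with it and has the same averages. -/
theorem StablySynchronising.ae_tendsto_timeMean_forall [IsProbabilityMeasure P]
    (hθ : IsNoise P ℱ θ) (hφ : IsRDS ℱ θ φ) (h : StablySynchronising P φ) {ρ : Measure Circ}
    (hρ : IsStationaryMeasure P φ ρ) (f : C(Circ, ℝ)) :
    ∀ᵐ ω ∂P, ∀ x, x ≠ crackFun φ ω →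
      Tendsto (TimeDomain.timeMean fun t => f (φ t ω x)) atTop (𝓝 (∫ y, f y ∂ρ)) := by
  filter_upwards [h.ae_tendsto_timeMean hθ hφ hρ f 0,
    ae_mem_contractiveSet hφ (h.contractiveSet_eq_one hθ hφ),
    measure_eq_zero_iff_ae_notMem.1 (h.crackEvent_eq_zero hθ hφ 0)] with ω h1 hω h2 x hx
  rw [crackEvent_eq] at h2
  have h0 : (0 : Circ) ≠ crackFun φ ω := fun h => h2 ⟨hω, h.symm⟩
  have hm : ∀ y, Measurable fun t => f (φ t ω y) := fun y =>
    f.continuous.measurable.comp ((hφ.measurable_time y).comp measurable_prodMk_right)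
  have hi : ∀ y T, IntegrableOn (fun t => f (φ t ω y)) (k.before T) k.timeMeasure := fun y T =>
    TimeDomain.integrableOn_before (hm y) (fun t => abs_apply_le_norm f _) T
  have hdiff := TimeDomain.tendsto_timeMean_zero ((hm x).sub (hm 0)) (C := ‖f‖ + ‖f‖)
    (fun t => (abs_sub _ _).trans (add_le_add (abs_apply_le_norm f _) (abs_apply_le_norm f _)))
    (tendsto_sub_of_tendsto_dist f ((isCrackPoint_crackFun hω).synced hx h0))
  have := hdiff.add h1
  rw [zero_add] at this
  refine this.congr fun T => ?_
  simp only [TimeDomain.timeMean, Pi.sub_apply]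
  rw [integral_sub (hi x T) (hi 0 T)]
  ring

theorem timeMean_mono {g h : k.Time → ℝ} {T : ℝ} (hT : 0 ≤ T)
    (hg : IntegrableOn g (k.before T) k.timeMeasure)
    (hh : IntegrableOn h (k.before T) k.timeMeasure) (hgh : ∀ t, g t ≤ h t) :
    TimeDomain.timeMean g T ≤ TimeDomain.timeMean h T :=
  mul_le_mul_of_nonneg_left (integral_mono hg hh hgh) (by positivity)

theorem StablySynchronising.ae_tendsto_timeAverage [IsProbabilityMeasure P] (hθ : IsNoise P ℱ θ)
    (hφ : IsRDS ℱ θ φ) (h : StablySynchronising P φ) {ρ : Measure Circ}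
    (hρ : IsStationaryMeasure P φ ρ) {J : Set Circ} (hJ : IsPreconnected J)
    (hJf : ∀ p ∈ frontier J, ¬ IsDetFixedPoint P φ p) :
    ∀ᵐ ω ∂P, ∀ x, x ≠ crackFun φ ω →
      Tendsto (fun T : ℝ => timeAverage φ ω x J T) atTop (𝓝 (ρ.real J)) := by
  have := hρ.1
  have hJm : MeasurableSet J := Circ.measurableSet_of_isPreconnected hJ
  have hnull : ρ (frontier J) = 0 := by
    rw [← Set.biUnion_of_singleton (frontier J),
      measure_biUnion_null_iff (Circ.finite_frontier hJ).countable]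
    exact fun p hp => h.1.measure_singleton_eq_zero hφ hρ (hJf p hp)
  have hcl : ρ.real (closure J) = ρ.real J := by
    rw [Measure.real, measure_closure_of_null_frontier hnull]; rfl
  have hIntg : ρ.real (interior J)ᶜ = 1 - ρ.real J := by
    rw [probReal_compl_eq_one_sub isOpen_interior.measurableSet, Measure.real,
      measure_interior_of_null_frontier hnull]
    rfl
  -- `G m` bounds `J` from above through its closure, `1 - H m` from below through its interior.
  -- Their integrals approach the same value since the frontier is null, and countably many
  -- functions keep the exceptional set null.
  choose G hG hGρ using fun m : ℕ => exists_continuousMap_ge_indicator ρ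
    (isClosed_closure (s := J)) (Nat.one_div_pos_of_nat (n := m) (α := ℝ))
  choose H hH hHρ using fun m : ℕ => exists_continuousMap_ge_indicator ρ
    (isOpen_interior (s := J)).isClosed_compl (Nat.one_div_pos_of_nat (n := m) (α := ℝ))
  filter_upwards [ae_all_iff.2 fun m => h.ae_tendsto_timeMean_forall hθ hφ hρ (G m),
    ae_all_iff.2 fun m => h.ae_tendsto_timeMean_forall hθ hφ hρ (1 - H m)] with ω hGω hHω x hx
  have hxm : Measurable fun t => φ t ω x := (hφ.measurable_time x).comp measurable_prodMk_right
  have hfi : ∀ (f : C(Circ, ℝ)) T,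
      IntegrableOn (fun t => f (φ t ω x)) (k.before T) k.timeMeasure := fun f T =>
    TimeDomain.integrableOn_before (f.continuous.measurable.comp hxm)
      (fun t => abs_apply_le_norm f _) T
  have hJi : ∀ T, IntegrableOn (fun t => J.indicator (fun _ => (1 : ℝ)) (φ t ω x)) (k.before T)
      k.timeMeasure := fun T =>
    TimeDomain.integrableOn_before ((measurable_const.indicator hJm).comp hxm) (C := 1)
      (fun t => by
        by_cases ht : φ t ω x ∈ J
        · simp [ht]
        · simp [ht]) T
  have hup : ∀ m z, J.indicator (fun _ => (1 : ℝ)) z ≤ G m z := fun m z =>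
    (Set.indicator_le_indicator_of_subset subset_closure (fun _ => zero_le_one) z).trans (hG m z)
  have hlow : ∀ m z, (1 - H m) z ≤ J.indicator (fun _ => (1 : ℝ)) z := by
    intro m z
    have hz := hH m z
    simp only [ContinuousMap.sub_apply, ContinuousMap.one_apply]
    by_cases hzi : z ∈ interior J
    · rw [Set.indicator_of_notMem (by simpa using hzi)] at hz
      rw [Set.indicator_of_mem (interior_subset hzi)]
      linarith
    · rw [Set.indicator_of_mem (by simpa using hzi)] at hz
      have : (0 : ℝ) ≤ J.indicator (fun _ => (1 : ℝ)) z :=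
        Set.indicator_nonneg (fun _ _ => zero_le_one) z
      linarith
  have heq : ∀ T, timeAverage φ ω x J T =
      TimeDomain.timeMean (fun t => J.indicator (fun _ => (1 : ℝ)) (φ t ω x)) T := fun _ => rfl
  simp only [heq]
  rw [tendsto_order]
  constructor
  · intro a ha
    obtain ⟨m, hm⟩ := exists_nat_one_div_lt (sub_pos.2 ha)
    have hlim : a < ∫ y, (1 - H m) y ∂ρ := by
      have h1 : ∫ y, (1 - H m) y ∂ρ = 1 - ∫ y, H m y ∂ρ := by
        simp only [ContinuousMap.sub_apply, ContinuousMap.one_apply]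
        rw [integral_sub (integrable_const _) (Integrable.of_bound
          (H m).continuous.aestronglyMeasurable ‖H m‖
          (Eventually.of_forall (abs_apply_le_norm (H m))))]
        simp
      have h2 := hHρ m
      rw [hIntg] at h2
      linarith
    filter_upwards [(hHω m x hx).eventually_const_lt hlim, eventually_ge_atTop 0] with T hT hT0
    exact hT.trans_le (timeMean_mono hT0 (hfi _ T) (hJi T) fun t => hlow m _)
  · intro a ha
    obtain ⟨m, hm⟩ := exists_nat_one_div_lt (sub_pos.2 ha)
    have hlim : ∫ y, G m y ∂ρ < a := by
      have h2 := hGρ m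
      rw [hcl] at h2
      linarith
    filter_upwards [(hGω m x hx).eventually_lt_const hlim, eventually_ge_atTop 0] with T hT hT0
    exact (timeMean_mono hT0 (hJi T) (hfi _ T) fun t => hup m _).trans_lt hT

end LLN

/-! ### Assembly of the theorem -/

theorem theorem4p5 {k : TimeDomain} {Ω : Type*} [mΩ : MeasurableSpace Ω]
    (P : Measure Ω) [IsProbabilityMeasure P] (ℱ : Filtration k.Time mΩ)
    (θ : k.Time → Ω → Ω) (hθ : IsNoise P ℱ θ)
    (φ : k.Time → Ω → (Circ ≃ₜ Circ)) (hφ : IsRDS ℱ θ φ) :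
    -- the event in question is measurable with respect to the future, and has probability 0 or 1
    MeasurableSet[futureSigma ℱ] (contractiveSet φ) ∧
    (P (contractiveSet φ) = 0 ∨ P (contractiveSet φ) = 1) ∧
    -- the dichotomy for the law of the crack point
    (P (contractiveSet φ) = 1 →
      (∀ x, P (crackEvent φ x) = 0) ∨
      (∃ p, IsDetFixedPoint P φ p ∧ ∀ᵐ ω ∂P, ω ∈ crackEvent φ p)) ∧
    -- the characterisation of stable synchronisation
    (StablySynchronising P φ ↔
      P (contractiveSet φ) = 1 ∧ ∀ x, P (crackEvent φ x) = 0) ∧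
    -- its consequences
    (StablySynchronising P φ →
      (∀ᵐ ω ∂P, ∀ h : ω ∈ contractiveSet φ,
        IsRepulsiveCrackPoint φ ω (crackPoint φ ⟨ω, h⟩)) ∧
      (∃ ρ : Measure Circ, IsStationaryMeasure P φ ρ ∧
        (∀ ρ' : Measure Circ, IsStationaryMeasure P φ ρ' → ρ' = ρ) ∧
        ∀ J : Set Circ, IsPreconnected J → (∀ p ∈ frontier J, ¬ IsDetFixedPoint P φ p) →
          ∀ᵐ ω ∂P, ∀ h : ω ∈ contractiveSet φ, ∀ x, x ≠ crackPoint φ ⟨ω, h⟩ →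
            Tendsto (fun T : ℝ => timeAverage φ ω x J T) atTop (𝓝 (ρ.real J)))) := by
  refine ⟨measurableSet_contractiveSet hφ, contractiveSet_zero_one hθ hφ,
    crackPoint_dichotomy hθ hφ, ⟨fun h => ⟨h.contractiveSet_eq_one hθ hφ,
      h.crackEvent_eq_zero hθ hφ⟩, fun h => stablySynchronising_of_crackPoint hφ h.1 h.2⟩,
    fun h => ⟨ae_isRepulsiveCrackPoint hθ hφ (h.contractiveSet_eq_one hθ hφ)
      (h.crackEvent_eq_zero hθ hφ), ?_⟩⟩
  obtain ⟨ρ, hρ⟩ := h.1.exists_isStationaryMeasure hθ hφ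
  refine ⟨ρ, hρ, fun ρ' hρ' => h.1.stationary_unique hφ hρ hρ', fun J hJ hJf => ?_⟩
  filter_upwards [h.ae_tendsto_timeAverage hθ hφ hρ hJ hJf] with ω hω hc x hx
  rw [← crackFun_eq hc] at hx
  exact hω x hx
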